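/- For integers $n,k\ge 0$ with $k\le n/3$ define the following (classes of) graphs on $n$ vertices. - $E_1(n,k)$: the vertex set is a disjoint union $X\cup Y_1\cup Y_2$ with $|X|=k$, $|Y_1|=\lceil\frac{n-k}2\rceil$, $|Y_2|=\lfloor\frac{n-k}2\rfloor$; the edges are all pairs meeting $X$ and all pairs between $Y_1$ and $Y_2$. - $E_2(n,k)$, defined only for $k<\frac{n-1}4$: the vertex set is a disjoint union $X\cup Y_1\cup Y_2$ with $|X|=2k+1$ and either $|Y_1|=\lfloor\frac n2\rfloor$, $|Y_2|=\lceil\frac n2\rceil-2k-1$, or $|Y_1|=\lceil\frac n2\rceil$, $|Y_2|=\lfloor\frac n2\rfloor-2k-1$; the edges are all pairs inside $X$ and all pairs between $Y_1$ and $X\cup Y_2$. - $E_3(n,k)$: the vertex set is a disjoint union $X\cup Y_1$ with $|X|=2k+1$, $|Y_1|=n-2k-1$; the edges are all pairs meeting $X$. - $E_4(n,k)$, defined only for $6k-n+4\ge 0$: if $k\ge\frac{n-2}3$ it is the complete graph $K_n$; otherwise the vertex set is a disjoint union $X\cup Y_1\cup Y_2\cup Y_3\cup Y_4$ with $|Y_1|=|Y_3|$,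 $|Y_2|=|Y_4|$, $|Y_1|+|Y_2|=n-3k-2$, $|X|=6k-n+4$; the edges are all pairs inside $X$, all pairs between $X$ and $Y_1\cup Y_2$, and all pairs between $Y_1\cup Y_4$ and $Y_2\cup Y_3$. Where $E_j(n,k)$ is a class of several graphs, all of them have the same number of edges; write $e(E_j(n,k))$ for this number, and $e(G)$ for the number of edges of a graph $G$. Theorem. There is an absolute constant $n_0$ such that for every $n>n_0$ and every integer $k$ with $0\le k\le n/3$ the following holds. If $G$ is a graph on $n$ vertices that does not contain $k+1$ vertex-disjoint triangles, then $$e(G)\le\max_{j\in\{1,2,3,4\}} e\big(E_j(n,k)\big),$$ where the maximum is over those $j$ for which $E_j(n,k)$ is defined. -/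

import Mathlib

namespace DensityCH

/-- `G` contains `l` vertex-disjoint (not necessarily induced) triangles. -/
def HasDisjointTriangles {V : Type*} (G : SimpleGraph V) (l : ℕ) : Prop :=
  ∃ T : Fin l → Finset V,
    (∀ i, G.IsNClique 3 (T i)) ∧ ∀ i j, i ≠ j → Disjoint (T i) (T j)

/-- The number of edges `e(G)` (used for graphs on finite vertex sets only). -/
noncomputable def numEdges {V : Type*} (G : SimpleGraph V) : ℕ :=
  G.edgeSet.ncard

/-- The (possibly empty) sets in the list `L` partition the vertex set. -/
def Partitions {n : ℕ} (L : List (Finset (Fin n))) : Prop :=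
  L.Pairwise Disjoint ∧ ∀ v, ∃ A ∈ L, v ∈ A

/-- The pair `u, v` goes between `A` and `B`. -/
def Between {n : ℕ} (A B : Finset (Fin n)) (u v : Fin n) : Prop :=
  (u ∈ A ∧ v ∈ B) ∨ (u ∈ B ∧ v ∈ A)

/-- `H` is a graph `E₁(n,k)`: `|X| = k`, `|Y₁| = ⌈(n-k)/2⌉`, `|Y₂| = ⌊(n-k)/2⌋`; all edges
meeting `X` and all edges between `Y₁` and `Y₂`. -/
def IsE₁ (n k : ℕ) (H : SimpleGraph (Fin n)) : Prop :=
  ∃ X Y₁ Y₂ : Finset (Fin n), Partitions [X, Y₁, Y₂] ∧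
    X.card = k ∧ Y₁.card = (n - k + 1) / 2 ∧ Y₂.card = (n - k) / 2 ∧
    ∀ u v, H.Adj u v ↔ u ≠ v ∧ (u ∈ X ∨ v ∈ X ∨ Between Y₁ Y₂ u v)

/-- `H` is one of the graphs `E₂(n,k)`, defined for `k < (n-1)/4` only: `|X| = 2k+1` and
`|Y₁| = ⌊n/2⌋`, `|Y₂| = ⌈n/2⌉-2k-1`, or `|Y₁| = ⌈n/2⌉`, `|Y₂| = ⌊n/2⌋-2k-1`; all edges inside `X`
and all edges between `Y₁` and `X ∪ Y₂`. -/
def IsE₂ (n k : ℕ) (H : SimpleGraph (Fin n)) : Prop :=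
  4 * k + 1 < n ∧
  ∃ X Y₁ Y₂ : Finset (Fin n), Partitions [X, Y₁, Y₂] ∧
    X.card = 2 * k + 1 ∧
    ((Y₁.card = n / 2 ∧ Y₂.card + (2 * k + 1) = (n + 1) / 2) ∨
      (Y₁.card = (n + 1) / 2 ∧ Y₂.card + (2 * k + 1) = n / 2)) ∧
    ∀ u v, H.Adj u v ↔ u ≠ v ∧ ((u ∈ X ∧ v ∈ X) ∨ Between Y₁ (X ∪ Y₂) u v)

/-- `H` is a graph `E₃(n,k)`: `|X| = 2k+1`, `|Y₁| = n-2k-1`; all edges meeting `X`. -/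
def IsE₃ (n k : ℕ) (H : SimpleGraph (Fin n)) : Prop :=
  ∃ X Y₁ : Finset (Fin n), Partitions [X, Y₁] ∧
    X.card = 2 * k + 1 ∧ Y₁.card + (2 * k + 1) = n ∧
    ∀ u v, H.Adj u v ↔ u ≠ v ∧ (u ∈ X ∨ v ∈ X)

/-- `H` is one of the graphs `E₄(n,k)`, defined for `k ≥ n/6 - 2` only. If `k ≥ (n-2)/3` this is the
complete graph. Otherwise `|Y₁| = |Y₃|`, `|Y₂| = |Y₄|`, `|Y₁| + |Y₂| = n-3k-2`, `|X| = 6k-n+4`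
(so that there is no such graph if `6k-n+4 < 0`); all edges inside `X`, between `X` and `Y₁ ∪ Y₂`,
and between `Y₁ ∪ Y₄` and `Y₂ ∪ Y₃`. -/
def IsE₄ (n k : ℕ) (H : SimpleGraph (Fin n)) : Prop :=
  n ≤ 6 * k + 12 ∧
  ((n ≤ 3 * k + 2 ∧ H = ⊤) ∨
   (3 * k + 2 < n ∧
    ∃ X Y₁ Y₂ Y₃ Y₄ : Finset (Fin n), Partitions [X, Y₁, Y₂, Y₃, Y₄] ∧
      Y₁.card = Y₃.card ∧ Y₂.card = Y₄.card ∧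
      Y₁.card + Y₂.card + (3 * k + 2) = n ∧ X.card + n = 6 * k + 4 ∧
      ∀ u v, H.Adj u v ↔ u ≠ v ∧
        ((u ∈ X ∧ v ∈ X) ∨ Between X (Y₁ ∪ Y₂) u v ∨ Between (Y₁ ∪ Y₄) (Y₂ ∪ Y₃) u v)))

/-- The four classes of extremal graphs; the index `j : Fin 4` stands for `E_{j+1}(n,k)`. -/
def extremalClass (n k : ℕ) (j : Fin 4) : Set (SimpleGraph (Fin n)) :=
  {H | (![IsE₁ n k, IsE₂ n k, IsE₃ n k, IsE₄ n k] j) H}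

/-- The class with index `j` is nonempty (the construction is defined for `n`, `k`), and `m` is the
common number of edges of its members. -/
def IsExtremalEdgeNumber (n k : ℕ) (j : Fin 4) (m : ℕ) : Prop :=
  (extremalClass n k j).Nonempty ∧ ∀ H ∈ extremalClass n k j, numEdges H = m

end DensityCH

/-! ### Degrees into vertex sets and families of disjoint cliques. -/

namespace DensityCH

/-! Take a minimal counterexample `G`, with `n` vertices, no `k + 1` disjoint triangles and more
than `maxNum n k` edges. Deleting a vertex keeps the hypothesis for `k`, and deleting a triangle
gives it for `k - 1`. By induction every degree exceeds `maxNum n k - maxNum (n - 1) k`, and the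
degree sum of every triangle exceeds `maxNum n k - maxNum (n - 3) (k - 1)` by at least 4. As
`maxNum` grows with `k`, there are also `k` disjoint triangles. With these conditions there are two
regimes.

If `n ≥ 4k + 3`, degrees exceed `n / 2` and triangles have degree sum at least `2n + k`. Choose `k`
disjoint triangles with a largest matching outside them. The matching edges and the unmatched
vertices send many edges to the triangles, while exchanges that would produce another triangle or a
larger matching limit how many they can send. The counts clash
(`hasDisjointTriangles_succ_of_sparse`).

If `3k + 3 ≤ n ≤ 4k + 2`, write `n = 3k + 2 + μ` and let `L` be the set of vertices in no triangle.
If `|L| < μ`, the degree sums leave `3(k + 1)` vertices spanning minimum degree at least `2(k + 1)`,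
and the Corrádi–Hajnal theorem (`corradi_hajnal`) tiles them. If `|L| ≥ μ`, the ends of any edge at
`L` have no common neighbour, and deleting such edges one by one bounds `e(G)` by `num₄` or `num₃`
(`hasDisjointTriangles_or_degSum_le`).

What remains is arithmetic: the increments of `maxNum` match the degree conditions of the two
regimes, and `maxNum` is the maximum over the extremal graphs. No lower bound on `n` is needed. -/

open scoped Classical in
/-- The number of neighbours of `v` in `A`. -/
noncomputable def degIn {V : Type*} (G : SimpleGraph V) (A : Finset V) (v : V) : ℕ :=
  (A.filter (G.Adj v)).card

/-- Twice the number of edges inside `A`. -/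
noncomputable def degSum {V : Type*} (G : SimpleGraph V) (A : Finset V) : ℕ :=
  ∑ v ∈ A, degIn G A v

/-- A family of pairwise disjoint cliques of size `r`. -/
structure IsTiling {V : Type*} (G : SimpleGraph V) (r : ℕ) (𝒯 : Finset (Finset V)) : Prop where
  clique : ∀ t ∈ 𝒯, G.IsNClique r t
  disj : ∀ s ∈ 𝒯, ∀ t ∈ 𝒯, s ≠ t → Disjoint s t

section Basics

open scoped Classical

variable {V : Type*} {G : SimpleGraph V}

lemma degIn_le_card (A : Finset V) (v : V) : degIn G A v ≤ A.card :=
  Finset.card_filter_le _ _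

lemma degIn_mono {A B : Finset V} (h : A ⊆ B) (v : V) : degIn G A v ≤ degIn G B v :=
  Finset.card_le_card (Finset.filter_subset_filter _ h)

lemma degIn_union {A B : Finset V} (h : Disjoint A B) (v : V) :
    degIn G (A ∪ B) v = degIn G A v + degIn G B v := by
  unfold degIn
  rw [Finset.filter_union, Finset.card_union_of_disjoint]
  exact Finset.disjoint_filter_filter h

lemma degIn_sdiff {A B : Finset V} (h : A ⊆ B) (v : V) :
    degIn G A v + degIn G (B \ A) v = degIn G B v := by
  rw [← degIn_union Finset.disjoint_sdiff, Finset.union_sdiff_of_subset h]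

lemma degIn_biUnion {ι : Type*} {s : Finset ι} {f : ι → Finset V}
    (h : ∀ i ∈ s, ∀ j ∈ s, i ≠ j → Disjoint (f i) (f j)) (v : V) :
    degIn G (s.biUnion f) v = ∑ i ∈ s, degIn G (f i) v := by
  unfold degIn
  rw [Finset.filter_biUnion, Finset.card_biUnion]
  intro i hi j hj hij
  exact Finset.disjoint_filter_filter (h i hi j hj hij)

lemma degIn_singleton (w v : V) : degIn G {w} v = if G.Adj v w then 1 else 0 := by
  unfold degIn
  rw [Finset.filter_singleton]
  split_ifs <;> simp

lemma degIn_insert {A : Finset V} {w : V} (h : w ∉ A) (v : V) :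
    degIn G (insert w A) v = (if G.Adj v w then 1 else 0) + degIn G A v := by
  rw [Finset.insert_eq, degIn_union (by simpa using h), degIn_singleton]

lemma degIn_pair {a b : V} (hab : a ≠ b) (v : V) :
    degIn G {a, b} v = (if G.Adj v a then 1 else 0) + (if G.Adj v b then 1 else 0) := by
  rw [degIn_insert (by simpa using hab), degIn_singleton]

lemma degIn_triple {a b c : V} (hab : a ≠ b) (hac : a ≠ c) (hbc : b ≠ c) (v : V) :
    degIn G {a, b, c} v = (if G.Adj v a then 1 else 0) + (if G.Adj v b then 1 else 0)
      + (if G.Adj v c then 1 else 0) := by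
  rw [degIn_insert (by simp [hab, hac]), degIn_pair hbc, add_assoc]

lemma degIn_eq_card_iff (A : Finset V) (v : V) :
    degIn G A v = A.card ↔ ∀ w ∈ A, G.Adj v w := by
  unfold degIn
  rw [Finset.card_filter_eq_iff]

lemma degIn_eq_zero_iff (A : Finset V) (v : V) :
    degIn G A v = 0 ↔ ∀ w ∈ A, ¬ G.Adj v w := by
  unfold degIn
  rw [Finset.card_eq_zero, Finset.filter_eq_empty_iff]

lemma degIn_eq_sum (A : Finset V) (v : V) :
    degIn G A v = ∑ w ∈ A, if G.Adj v w then 1 else 0 := by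
  unfold degIn
  rw [Finset.card_filter]

lemma sum_degIn_comm (A B : Finset V) :
    ∑ v ∈ A, degIn G B v = ∑ w ∈ B, degIn G A w := by
  simp only [degIn_eq_sum]
  rw [Finset.sum_comm]
  simp only [G.adj_comm]

/-- Two vertices with no common neighbour in `A` have at most `|A|` neighbours there in total. -/
lemma degIn_add_degIn_le {A : Finset V} {u v : V}
    (h : ∀ w ∈ A, G.Adj u w → ¬ G.Adj v w) : degIn G A u + degIn G A v ≤ A.card := by
  unfold degIn
  rw [← Finset.card_union_of_disjoint]
  · exact Finset.card_le_card
      (Finset.union_subset (Finset.filter_subset _ _) (Finset.filter_subset _ _))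
  · rw [Finset.disjoint_filter]
    exact h

lemma exists_common_of_card_lt {A : Finset V} {u v : V}
    (h : A.card < degIn G A u + degIn G A v) : ∃ w ∈ A, G.Adj u w ∧ G.Adj v w := by
  by_contra hc
  push Not at hc
  exact absurd (degIn_add_degIn_le hc) (by omega)

lemma degIn_insert_self (A : Finset V) (v : V) : degIn G (insert v A) v = degIn G A v := by
  by_cases h : v ∈ A
  · rw [Finset.insert_eq_of_mem h]
  · rw [degIn_insert h]; simp

lemma degIn_lt_card {A : Finset V} {v : V} (h : v ∈ A) : degIn G A v < A.card := by
  have := degIn_insert_self (G := G) (A.erase v) v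
  rw [Finset.insert_erase h] at this
  have h2 := degIn_le_card (G := G) (A.erase v) v
  have h3 := Finset.card_erase_lt_of_mem h
  omega

lemma degSum_insert {A : Finset V} {v : V} (h : v ∉ A) :
    degSum G (insert v A) = degSum G A + 2 * degIn G A v := by
  unfold degSum
  rw [Finset.sum_insert h, degIn_insert_self]
  have : ∑ w ∈ A, degIn G (insert v A) w = degIn G A v + ∑ w ∈ A, degIn G A w := by
    rw [degIn_eq_sum, ← Finset.sum_add_distrib]
    refine Finset.sum_congr rfl fun w _ => ?_
    rw [degIn_insert h]
    simp only [G.adj_comm]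
  omega

lemma degSum_erase {A : Finset V} {v : V} (h : v ∈ A) :
    degSum G A = degSum G (A.erase v) + 2 * degIn G A v := by
  conv_lhs => rw [← Finset.insert_erase h]
  rw [degSum_insert (Finset.notMem_erase _ _)]
  conv_rhs => rw [← Finset.insert_erase h]
  rw [degIn_insert_self, Finset.insert_erase h]

/-- The effect of deleting both ends of an edge. -/
lemma degSum_erase_edge {A : Finset V} {v w : V} (hv : v ∈ A) (hw : w ∈ A) (h : G.Adj v w) :
    degSum G A + 2 = degSum G ((A.erase v).erase w) + 2 * (degIn G A v + degIn G A w) := by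
  have hwv : w ∈ A.erase v := Finset.mem_erase.2 ⟨h.ne', hw⟩
  rw [degSum_erase hv, degSum_erase hwv]
  have := degIn_insert (G := G) (Finset.notMem_erase v A) w
  rw [Finset.insert_erase hv, if_pos h.symm] at this
  omega

lemma degSum_le (A : Finset V) : degSum G A ≤ A.card * (A.card - 1) := by
  unfold degSum
  calc ∑ v ∈ A, degIn G A v ≤ ∑ _v ∈ A, (A.card - 1) := by
        refine Finset.sum_le_sum fun v hv => ?_
        have := degIn_lt_card (G := G) hv
        omega
    _ = _ := by simp

lemma degSum_univ [Fintype V] : degSum G Finset.univ = 2 * numEdges G := by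
  unfold degSum numEdges
  rw [← SimpleGraph.coe_edgeFinset, Set.ncard_coe_finset, ← SimpleGraph.sum_degrees_eq_twice_card_edges]
  refine Finset.sum_congr rfl fun v _ => ?_
  rw [← SimpleGraph.card_neighborFinset_eq_degree]
  unfold degIn
  congr 1
  ext w
  simp

lemma degIn_induce [Fintype V] (W : Finset V) (v : (W : Set V)) :
    degIn (G.induce (W : Set V)) Finset.univ v = degIn G W v := by
  unfold degIn
  rw [← Finset.card_map (Function.Embedding.subtype (· ∈ (W : Set V)))]
  congr 1
  ext w
  simp [and_comm]

lemma degSum_induce [Fintype V] (W : Finset V) :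
    degSum (G.induce (W : Set V)) Finset.univ = degSum G W := by
  unfold degSum
  rw [← Finset.sum_coe_sort W]
  exact Finset.sum_congr (by ext; simp) fun v _ => degIn_induce W v

lemma two_mul_numEdges_induce [Fintype V] (W : Finset V) :
    2 * numEdges (G.induce (W : Set V)) = degSum G W := by
  rw [← degSum_induce, degSum_univ]

lemma isNClique_triple {a b c : V} (hab : G.Adj a b) (hac : G.Adj a c) (hbc : G.Adj b c) :
    G.IsNClique 3 {a, b, c} := by
  rw [SimpleGraph.is3Clique_triple_iff]
  exact ⟨hab, hac, hbc⟩

lemma isNClique_pair {a b : V} (hab : G.Adj a b) : G.IsNClique 2 {a, b} := by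
  rw [SimpleGraph.isNClique_iff, Finset.coe_pair, SimpleGraph.isClique_pair]
  exact ⟨fun _ => hab, Finset.card_pair hab.ne⟩

namespace IsTiling

variable {r : ℕ} {𝒯 : Finset (Finset V)}

lemma card_biUnion (h : IsTiling G r 𝒯) : (𝒯.biUnion id).card = r * 𝒯.card := by
  rw [Finset.card_biUnion (t := id) (fun s hs t ht hst => h.disj s hs t ht hst),
    Finset.sum_congr rfl fun t ht => show (id t).card = r from (h.clique t ht).card_eq]
  simp [mul_comm]

lemma degIn_biUnion_id (h : IsTiling G r 𝒯) (v : V) :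
    degIn G (𝒯.biUnion id) v = ∑ t ∈ 𝒯, degIn G t v :=
  degIn_biUnion h.disj v

lemma subset (h : IsTiling G r 𝒯) {𝒮 : Finset (Finset V)} (hs : 𝒮 ⊆ 𝒯) : IsTiling G r 𝒮 :=
  ⟨fun t ht => h.clique t (hs ht), fun s hs' t ht => h.disj s (hs hs') t (hs ht)⟩

lemma empty : IsTiling G r ∅ := ⟨by simp, by simp⟩

lemma union {𝒮 : Finset (Finset V)} (hT : IsTiling G r 𝒯) (hS : IsTiling G r 𝒮)
    (h : ∀ s ∈ 𝒮, ∀ t ∈ 𝒯, Disjoint s t) : IsTiling G r (𝒯 ∪ 𝒮) := by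
  refine ⟨fun t ht => ?_, fun s hs t ht hst => ?_⟩
  · rcases Finset.mem_union.1 ht with h1 | h1
    exacts [hT.clique t h1, hS.clique t h1]
  · rcases Finset.mem_union.1 hs with h1 | h1 <;> rcases Finset.mem_union.1 ht with h2 | h2
    exacts [hT.disj s h1 t h2 hst, (h t h2 s h1).symm, h s h1 t h2, hS.disj s h1 t h2 hst]

/-- For `r = 0` the empty clique could lie in both families; `0 < r` excludes this. -/
lemma card_union (hr : 0 < r) {𝒮 : Finset (Finset V)} (hS : IsTiling G r 𝒮)
    (h : ∀ s ∈ 𝒮, ∀ t ∈ 𝒯, Disjoint s t) : (𝒯 ∪ 𝒮).card = 𝒯.card + 𝒮.card := by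
  refine Finset.card_union_of_disjoint (Finset.disjoint_left.2 fun t ht hs => ?_)
  have h1 := h t hs t ht
  rw [disjoint_self, Finset.bot_eq_empty] at h1
  have h2 := (hS.clique t hs).card_eq
  rw [h1, Finset.card_empty] at h2
  omega

lemma singleton {t : Finset V} (ht : G.IsNClique r t) : IsTiling G r {t} :=
  ⟨by simpa using ht, by simp⟩

lemma pair {s t : Finset V} (hs : G.IsNClique r s) (ht : G.IsNClique r t) (h : Disjoint s t) :
    IsTiling G r {s, t} := by
  refine ⟨by simp [hs, ht], fun a ha b hb hab => ?_⟩
  simp only [Finset.mem_insert, Finset.mem_singleton] at ha hb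
  rcases ha with rfl | rfl <;> rcases hb with rfl | rfl
  exacts [absurd rfl hab, h, h.symm, absurd rfl hab]

/-- The part `𝒮` of a tiling may be replaced by any tiling `𝒮'` that uses only vertices of `𝒮`
and uncovered vertices. -/
lemma exists_replace [Fintype V] (hr : 0 < r) (hT : IsTiling G r 𝒯) {𝒮 𝒮' : Finset (Finset V)}
    (hS : 𝒮 ⊆ 𝒯) (hS' : IsTiling G r 𝒮')
    (h : ∀ s ∈ 𝒮', ∀ v ∈ s, v ∈ 𝒮.biUnion id ∨ v ∉ 𝒯.biUnion id) :
    IsTiling G r (𝒯 \ 𝒮 ∪ 𝒮') ∧ (𝒯 \ 𝒮 ∪ 𝒮').card + 𝒮.card = 𝒯.card + 𝒮'.card := by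
  have hd : ∀ s ∈ 𝒮', ∀ t ∈ 𝒯 \ 𝒮, Disjoint s t := by
    intro s hs t ht
    rw [Finset.mem_sdiff] at ht
    refine Finset.disjoint_left.2 fun v hvs hvt => ?_
    rcases h s hs v hvs with h1 | h1
    · obtain ⟨t', ht', hv'⟩ := Finset.mem_biUnion.1 h1
      have hne : t' ≠ t := by rintro rfl; exact ht.2 ht'
      exact Finset.disjoint_left.1 (hT.disj t' (hS ht') t ht.1 hne) hv' hvt
    · exact h1 (Finset.mem_biUnion.2 ⟨t, ht.1, hvt⟩)
  refine ⟨(hT.subset Finset.sdiff_subset).union hS' hd, ?_⟩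
  rw [card_union hr hS' hd]
  have := Finset.card_sdiff_add_card_eq_card hS
  omega

end IsTiling

lemma hasDisjointTriangles_iff {l : ℕ} :
    HasDisjointTriangles G l ↔ ∃ 𝒯, IsTiling G 3 𝒯 ∧ 𝒯.card = l := by
  constructor
  · rintro ⟨T, hT, hd⟩
    have hinj : Function.Injective T := by
      intro i j hij
      by_contra hne
      have h1 := hd i j hne
      rw [← hij, disjoint_self, Finset.bot_eq_empty] at h1
      have h2 := (hT i).card_eq
      rw [h1] at h2
      simp at h2
    refine ⟨Finset.univ.image T, ⟨?_, ?_⟩, ?_⟩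
    · intro t ht
      obtain ⟨i, -, rfl⟩ := Finset.mem_image.1 ht
      exact hT i
    · intro s hs t ht hst
      obtain ⟨i, -, rfl⟩ := Finset.mem_image.1 hs
      obtain ⟨j, -, rfl⟩ := Finset.mem_image.1 ht
      exact hd i j fun h => hst (by rw [h])
    · rw [Finset.card_image_of_injective _ hinj]; simp
  · rintro ⟨𝒯, h𝒯, rfl⟩
    refine ⟨fun i => (𝒯.equivFin.symm i : Finset V), fun i => h𝒯.clique _ (𝒯.equivFin.symm i).2,
      fun i j hij => h𝒯.disj _ (𝒯.equivFin.symm i).2 _ (𝒯.equivFin.symm j).2 fun h => hij ?_⟩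
    exact 𝒯.equivFin.symm.injective (Subtype.ext h)

/-- Replacing `𝒮` by a larger tiling of the available vertices. -/
lemma IsTiling.hasDisjointTriangles_of_replace [Fintype V] {𝒯 𝒮 𝒮' : Finset (Finset V)} {l : ℕ}
    (hT : IsTiling G 3 𝒯) (hS : 𝒮 ⊆ 𝒯) (hS' : IsTiling G 3 𝒮')
    (h : ∀ s ∈ 𝒮', ∀ v ∈ s, v ∈ 𝒮.biUnion id ∨ v ∉ 𝒯.biUnion id)
    (hl : l + 𝒮.card = 𝒯.card + 𝒮'.card) : HasDisjointTriangles G l := by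
  obtain ⟨h1, h2⟩ := hT.exists_replace (by norm_num) hS hS' h
  exact hasDisjointTriangles_iff.2 ⟨_, h1, by omega⟩

lemma hasDisjointTriangles_of_induce {s : Set V} {l : ℕ}
    (h : HasDisjointTriangles (G.induce s) l) : HasDisjointTriangles G l := by
  obtain ⟨T, hT, hd⟩ := h
  refine ⟨fun i => (T i).map (Function.Embedding.subtype (· ∈ s)), fun i => ?_, fun i j hij => ?_⟩
  · have h1 := (hT i).map (f := Function.Embedding.subtype (· ∈ s))
    exact h1.mono ((SimpleGraph.map_le_iff_le_comap _ _ _).2 le_rfl)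
  · rw [Finset.disjoint_map]
    exact hd i j hij

/-- Used contrapositively: removing a triangle lowers the forbidden number of triangles by one. -/
lemma hasDisjointTriangles_succ_of_induce {t : Finset V} {l : ℕ} (ht : G.IsNClique 3 t)
    {s : Finset V} (hs : Disjoint s t)
    (h : HasDisjointTriangles (G.induce (s : Set V)) l) : HasDisjointTriangles G (l + 1) := by
  obtain ⟨T, hT, hd⟩ := h
  refine ⟨Fin.cons t fun i => (T i).map (Function.Embedding.subtype (· ∈ (s : Set V))),
    fun i => ?_, fun i j hij => ?_⟩
  · refine Fin.cases ?_ (fun i => ?_) i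
    · exact ht
    · have h1 := (hT i).map (f := Function.Embedding.subtype (· ∈ (s : Set V)))
      exact h1.mono ((SimpleGraph.map_le_iff_le_comap _ _ _).2 le_rfl)
  · have key : ∀ i, Disjoint t ((T i).map (Function.Embedding.subtype (· ∈ (s : Set V)))) := by
      intro i
      refine Finset.disjoint_right.2 fun v hv => ?_
      obtain ⟨w, -, rfl⟩ := Finset.mem_map.1 hv
      exact Finset.disjoint_left.1 hs w.2
    refine Fin.cases (fun j hij => ?_) (fun i j hij => ?_) i j hij
    · refine Fin.cases (fun hij => absurd rfl hij) (fun j _ => ?_) j hij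
      exact key j
    · refine Fin.cases (fun _ => ?_) (fun j hij => ?_) j hij
      · exact (key i).symm
      · simp only [Fin.cons_succ]
        rw [Finset.disjoint_map]
        exact hd i j fun h => hij (by rw [h])

end Basics

end DensityCH

/-! ### Corrádi–Hajnal: the exchange argument around an uncovered path. -/

namespace DensityCH

section CorradiHajnal

open scoped Classical

variable {V : Type*} {G : SimpleGraph V}

/-- Boolean form of the degree, matching the finite check in `indicator_bound`. -/
lemma degIn_triple_toNat {a b c : V} (hab : a ≠ b) (hac : a ≠ c) (hbc : b ≠ c) (v : V) :
    degIn G {a, b, c} v = (decide (G.Adj v a)).toNat + (decide (G.Adj v b)).toNat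
      + (decide (G.Adj v c)).toNat := by
  rw [degIn_triple hab hac hbc]
  simp only [Bool.toNat, Bool.cond_decide]

variable [Fintype V]

lemma hasDisjointTriangles_top {l : ℕ} (h : 3 * l ≤ Fintype.card V) :
    HasDisjointTriangles (⊤ : SimpleGraph V) l := by
  induction l with
  | zero => exact hasDisjointTriangles_iff.2 ⟨∅, IsTiling.empty, rfl⟩
  | succ l ih =>
    obtain ⟨𝒯, h𝒯, hc⟩ := hasDisjointTriangles_iff.1 (ih (by omega))
    have hcard : 3 ≤ (Finset.univ \ 𝒯.biUnion id).card := by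
      rw [Finset.card_sdiff_of_subset (Finset.subset_univ _), h𝒯.card_biUnion, Finset.card_univ]
      omega
    obtain ⟨t, ht, htc⟩ := Finset.exists_subset_card_eq hcard
    have htt : (⊤ : SimpleGraph V).IsNClique 3 t := ⟨fun a _ b _ hab => hab, htc⟩
    refine h𝒯.hasDisjointTriangles_of_replace (Finset.empty_subset _) (IsTiling.singleton htt)
      ?_ (by simp [hc])
    intro s hs v hv
    rw [Finset.mem_singleton] at hs
    subst hs
    exact Or.inr (Finset.mem_sdiff.1 (ht hv)).2

/-- A triangle together with two more triangles from `t` and the uncovered vertices. -/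
lemma IsTiling.hasDisjointTriangles_of_two {𝒯 : Finset (Finset V)} (hT : IsTiling G 3 𝒯)
    {t s₁ s₂ : Finset V} (ht : t ∈ 𝒯) (h₁ : G.IsNClique 3 s₁) (h₂ : G.IsNClique 3 s₂)
    (hd : Disjoint s₁ s₂) (hs₁ : ∀ v ∈ s₁, v ∈ t ∨ v ∉ 𝒯.biUnion id)
    (hs₂ : ∀ v ∈ s₂, v ∈ t ∨ v ∉ 𝒯.biUnion id) : HasDisjointTriangles G (𝒯.card + 1) := by
  have hne : s₁ ≠ s₂ := by
    rintro rfl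
    rw [disjoint_self, Finset.bot_eq_empty] at hd
    have := h₁.card_eq
    simp [hd] at this
  refine hT.hasDisjointTriangles_of_replace (𝒮 := {t}) (by simpa using ht)
    (IsTiling.pair h₁ h₂ hd) ?_ ?_
  · intro s hs
    simp only [Finset.mem_insert, Finset.mem_singleton] at hs
    simp only [Finset.singleton_biUnion, id]
    rcases hs with rfl | rfl
    exacts [hs₁, hs₂]
  · rw [Finset.card_pair hne, Finset.card_singleton]

/-- Three disjoint triangles in the union of two triangles of a tiling and the uncovered
vertices. -/
lemma IsTiling.hasDisjointTriangles_of_three {𝒯 : Finset (Finset V)} (hT : IsTiling G 3 𝒯)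
    {t t' s₁ s₂ s₃ : Finset V} (ht : t ∈ 𝒯) (ht' : t' ∈ 𝒯) (htt : t ≠ t')
    (h₁ : G.IsNClique 3 s₁) (h₂ : G.IsNClique 3 s₂) (h₃ : G.IsNClique 3 s₃)
    (hd₁₂ : Disjoint s₁ s₂) (hd₁₃ : Disjoint s₁ s₃) (hd₂₃ : Disjoint s₂ s₃)
    (hs : ∀ s, s = s₁ ∨ s = s₂ ∨ s = s₃ → ∀ v ∈ s, v ∈ t ∨ v ∈ t' ∨ v ∉ 𝒯.biUnion id) :
    HasDisjointTriangles G (𝒯.card + 1) := by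
  have hd : ∀ s ∈ ({s₃} : Finset (Finset V)), ∀ t ∈ ({s₁, s₂} : Finset (Finset V)),
      Disjoint s t := by
    intro s hs t ht
    simp only [Finset.mem_insert, Finset.mem_singleton] at hs ht
    subst hs
    rcases ht with rfl | rfl
    exacts [hd₁₃.symm, hd₂₃.symm]
  have hne : s₁ ≠ s₂ := by
    rintro rfl
    rw [disjoint_self, Finset.bot_eq_empty] at hd₁₂
    have := h₁.card_eq
    simp [hd₁₂] at this
  refine hT.hasDisjointTriangles_of_replace (𝒮 := {t, t'}) ?_
    ((IsTiling.pair h₁ h₂ hd₁₂).union (IsTiling.singleton h₃) hd) ?_ ?_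
  · intro s hs
    simp only [Finset.mem_insert, Finset.mem_singleton] at hs
    rcases hs with rfl | rfl <;> assumption
  · intro s hs' v hv
    have := hs s (by simpa [or_assoc] using hs') v hv
    simpa [or_assoc] using this
  · rw [IsTiling.card_union (by norm_num) (IsTiling.singleton h₃) hd, Finset.card_pair hne,
      Finset.card_pair htt, Finset.card_singleton]

/-- The neighbourhoods in a triangle of four vertices `z, x, y, a`, given by indicators, subject to
conditions each of which excludes one pair of complementary triangles. -/
lemma indicator_bound (z₁ z₂ z₃ x₁ x₂ x₃ y₁ y₂ y₃ a₁ a₂ a₃ : Bool)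
    (h₁ : ¬(z₁ && y₁ && a₂ && a₃) ∧ ¬(z₂ && y₂ && a₁ && a₃) ∧ ¬(z₃ && y₃ && a₁ && a₂))
    (h₂ : ¬(x₁ && a₁ && z₂ && z₃) ∧ ¬(x₂ && a₂ && z₁ && z₃) ∧ ¬(x₃ && a₃ && z₁ && z₂))
    (h₃ : ¬(z₁ && x₁ && a₂ && a₃) ∧ ¬(z₂ && x₂ && a₁ && a₃) ∧ ¬(z₃ && x₃ && a₁ && a₂))
    (h₄ : ¬(z₁ && y₁ && x₂ && x₃) ∧ ¬(z₂ && y₂ && x₁ && x₃) ∧ ¬(z₃ && y₃ && x₁ && x₂))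
    (h₅ : ¬(z₁ && x₁ && y₂ && y₃) ∧ ¬(z₂ && x₂ && y₁ && y₃) ∧ ¬(z₃ && x₃ && y₁ && y₂)) :
    2 * (z₁.toNat + z₂.toNat + z₃.toNat) + (x₁.toNat + x₂.toNat + x₃.toNat)
      + (y₁.toNat + y₂.toNat + y₃.toNat) + 2 * (a₁.toNat + a₂.toNat + a₃.toNat) ≤ 12 := by
  -- Only twelve Booleans are involved, so all 4096 cases can be evaluated.
  revert z₁ z₂ z₃ x₁ x₂ x₃ y₁ y₂ y₃ a₁ a₂ a₃
  set_option maxRecDepth 100000 in decide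

/-- The weighted number of edges between a triangle of the tiling and the configuration formed by
the uncovered path `x z y` and another triangle. -/
lemma weighted_degIn_le {𝒯 : Finset (Finset V)} (hT : IsTiling G 3 𝒯)
    (hno : ¬ HasDisjointTriangles G (𝒯.card + 1))
    {x y z a b c : V} (hx : x ∉ 𝒯.biUnion id) (hy : y ∉ 𝒯.biUnion id) (hz : z ∉ 𝒯.biUnion id)
    (hne : x ≠ y) (hzx : G.Adj z x) (hzy : G.Adj z y) (h𝒯 : ({a, b, c} : Finset V) ∈ 𝒯)
    (hxa : G.Adj x a) (hxb : G.Adj x b) (hxc : G.Adj x c) (hyb : G.Adj y b) (hyc : G.Adj y c)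
    {t : Finset V} (ht : t ∈ 𝒯.erase {a, b, c}) :
    2 * degIn G t z + degIn G t x + degIn G t y + 2 * degIn G t a ≤ 12 := by
  obtain ⟨hab, hac, hbc⟩ := SimpleGraph.is3Clique_triple_iff.1 (hT.clique _ h𝒯)
  have hin : ∀ v ∈ ({a, b, c} : Finset V), v ∈ 𝒯.biUnion id := fun v hv =>
    Finset.mem_biUnion.2 ⟨_, h𝒯, hv⟩
  have ha := hin a (by simp)
  have hb := hin b (by simp)
  have hc := hin c (by simp)
  have out : ∀ {u w : V}, u ∉ 𝒯.biUnion id → w ∈ 𝒯.biUnion id → u ≠ w := by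
    rintro u w hu hw rfl
    exact hu hw
  have hxa' := hxa.ne
  have hxb' := hxb.ne
  have hxc' := hxc.ne
  have hyb' := hyb.ne
  have hyc' := hyc.ne
  have hya' := out hy ha
  have hza' := out hz ha
  have hzb' := out hz hb
  have hzc' := out hz hc
  have hzx' := hzx.ne
  have hzy' := hzy.ne
  have hab' := hab.ne
  have hac' := hac.ne
  have hbc' := hbc.ne
  obtain ⟨htne, ht⟩ := Finset.mem_erase.1 ht
  obtain ⟨d, e, f, hde, hdf, hef, rfl⟩ := SimpleGraph.is3Clique_iff.1 (hT.clique t ht)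
  have hd : ∀ v ∈ ({d, e, f} : Finset V), v ∈ 𝒯.biUnion id := fun v hv =>
    Finset.mem_biUnion.2 ⟨_, ht, hv⟩
  have hdd := hd d (by simp)
  have hde' := hd e (by simp)
  have hdf' := hd f (by simp)
  have hdisj := hT.disj _ ht _ h𝒯 htne
  have hdne := hde.ne
  have hdfne := hdf.ne
  have hefne := hef.ne
  have hnin : ∀ v ∈ ({x, y, z, a, b, c} : Finset V), v ≠ d ∧ v ≠ e ∧ v ≠ f := by
    intro v hv
    simp only [Finset.disjoint_insert_left, Finset.mem_insert, Finset.mem_singleton,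
      Finset.disjoint_singleton_left] at hdisj hv
    rcases hv with rfl | rfl | rfl | rfl | rfl | rfl
    · exact ⟨out hx hdd, out hx hde', out hx hdf'⟩
    · exact ⟨out hy hdd, out hy hde', out hy hdf'⟩
    · exact ⟨out hz hdd, out hz hde', out hz hdf'⟩
    all_goals grind
  have hnx := hnin x (by simp)
  have hny := hnin y (by simp)
  have hnz := hnin z (by simp)
  have hna := hnin a (by simp)
  have hnb := hnin b (by simp)
  have hnc := hnin c (by simp)
  clear hnin hdisj
  /- the triangles `u v p`, `w q r`, `s` for `{p, q, r} = {d, e, f}` -/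
  have three : ∀ {u v w s₁ s₂ s₃ : V}, G.Adj u v → G.Adj s₁ s₂ → G.Adj s₁ s₃ → G.Adj s₂ s₃ →
      ({u, v, w, s₁, s₂, s₃} : Finset V) ⊆ {x, y, z, a, b, c} →
      Disjoint ({s₁, s₂, s₃} : Finset V) {u, v, w} → w ≠ u → w ≠ v →
      ∀ {p q r : V}, G.Adj q r → p ≠ q → p ≠ r →
      ({p, q, r} : Finset V) = {d, e, f} →
      ¬ (G.Adj u p ∧ G.Adj v p ∧ G.Adj w q ∧ G.Adj w r) := by
    intro u v w s₁ s₂ s₃ huv hs12 hs13 hs23 hset hsd hwu hwv p q r hqr hpq hpr hpqr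
    rintro ⟨h1, h2, h3, h4⟩
    have hbig : ∀ v' ∈ ({u, v, w, s₁, s₂, s₃} : Finset V), v' ≠ d ∧ v' ≠ e ∧ v' ≠ f := by
      intro v' hv'
      have hv' := hset hv'
      simp only [Finset.mem_insert, Finset.mem_singleton] at hv'
      rcases hv' with rfl | rfl | rfl | rfl | rfl | rfl <;> assumption
    have hbig' : ∀ v' ∈ ({u, v, w, s₁, s₂, s₃} : Finset V), v' ≠ p ∧ v' ≠ q ∧ v' ≠ r := by
      intro v' hv'
      have hv2 := hbig v' hv'
      have : v' ∉ ({p, q, r} : Finset V) := by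
        rw [hpqr]; simpa using hv2
      simpa using this
    have hu := hbig' u (by simp)
    have hv := hbig' v (by simp)
    have hw := hbig' w (by simp)
    have hs1 := hbig' s₁ (by simp)
    have hs2 := hbig' s₂ (by simp)
    have hs3 := hbig' s₃ (by simp)
    simp only [Finset.disjoint_insert_left, Finset.mem_insert, Finset.mem_singleton,
      Finset.disjoint_singleton_left, not_or] at hsd
    refine hno (hT.hasDisjointTriangles_of_three h𝒯 ht (Ne.symm htne)
      (isNClique_triple huv h1 h2) (isNClique_triple h3 h4 hqr)
      (isNClique_triple hs12 hs13 hs23) ?_ ?_ ?_ ?_)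
    · simp; grind
    · simp; grind
    · simp; grind
    · intro s hs v' hv'
      have hcase : v' ∈ ({u, v, w, s₁, s₂, s₃} : Finset V) ∨ v' ∈ ({p, q, r} : Finset V) := by
        rcases hs with rfl | rfl | rfl <;>
        · simp only [Finset.mem_insert, Finset.mem_singleton] at hv'
          rcases hv' with rfl | rfl | rfl <;> simp
      rw [hpqr] at hcase
      rcases hcase with h | h
      · have h := hset h
        simp only [Finset.mem_insert, Finset.mem_singleton] at h
        rcases h with rfl | rfl | rfl | rfl | rfl | rfl
        · exact Or.inr (Or.inr hx)
        · exact Or.inr (Or.inr hy)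
        · exact Or.inr (Or.inr hz)
        all_goals exact Or.inl (by simp)
      · exact Or.inr (Or.inl h)
  have rot₂ : ({e, d, f} : Finset V) = {d, e, f} := Finset.insert_comm _ _ _
  have rot₃ : ({f, d, e} : Finset V) = {d, e, f} := by
    rw [Finset.insert_comm, Finset.pair_comm f e]
  have all : ∀ {u v w s₁ s₂ s₃ : V}, G.Adj u v → G.Adj s₁ s₂ → G.Adj s₁ s₃ → G.Adj s₂ s₃ →
      ({u, v, w, s₁, s₂, s₃} : Finset V) ⊆ {x, y, z, a, b, c} →
      Disjoint ({s₁, s₂, s₃} : Finset V) {u, v, w} → w ≠ u → w ≠ v →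
      ¬(decide (G.Adj u d) && decide (G.Adj v d) && decide (G.Adj w e) && decide (G.Adj w f)) ∧
      ¬(decide (G.Adj u e) && decide (G.Adj v e) && decide (G.Adj w d) && decide (G.Adj w f)) ∧
      ¬(decide (G.Adj u f) && decide (G.Adj v f) && decide (G.Adj w d) && decide (G.Adj w e)) := by
    intro u v w s₁ s₂ s₃ huv hs12 hs13 hs23 hset hsd hwu hwv
    have h1 := three huv hs12 hs13 hs23 hset hsd hwu hwv hef hdne hdfne rfl
    have h2 := three huv hs12 hs13 hs23 hset hsd hwu hwv hdf hdne.symm hefne rot₂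
    have h3 := three huv hs12 hs13 hs23 hset hsd hwu hwv hde hdfne.symm hefne.symm rot₃
    simp only [Bool.and_eq_true, decide_eq_true_eq, and_assoc]
    exact ⟨h1, h2, h3⟩
  simp only [degIn_triple_toNat hdne hdfne hefne]
  -- In each of the five exchanges two triangles use `t` and three of the six special vertices; the
  -- other three already form a triangle: `xbc`, `ybc`, `ybc`, `abc`, `abc` in turn.
  refine indicator_bound _ _ _ _ _ _ _ _ _ _ _ _
    (all (s₁ := x) (s₂ := b) (s₃ := c) hzy hxb hxc hbc ?_ ?_ ?_ ?_)
    (all (s₁ := y) (s₂ := b) (s₃ := c) hxa hyb hyc hbc ?_ ?_ ?_ ?_)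
    (all (s₁ := y) (s₂ := b) (s₃ := c) hzx hyb hyc hbc ?_ ?_ ?_ ?_)
    (all (s₁ := a) (s₂ := b) (s₃ := c) hzy hab hac hbc ?_ ?_ ?_ ?_)
    (all (s₁ := a) (s₂ := b) (s₃ := c) hzx hab hac hbc ?_ ?_ ?_ ?_)
  all_goals first
    | (simp only [Finset.insert_subset_iff, Finset.singleton_subset_iff]; simp)
    | assumption
    | (symm; assumption)
    | (simp [*, Ne.symm, eq_comm]; done)
    | (simp; grind)

/-- A tiling with three uncovered vertices that form a path `x z y` extends to a perfect one, if the
minimum degree is large and some triangle sends five edges to `x` and `y`. -/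
lemma exists_perfect_tiling_of_path {𝒯 : Finset (Finset V)} (hT : IsTiling G 3 𝒯)
    (hcard : Fintype.card V = 3 * (𝒯.card + 1))
    (hdeg : ∀ v, 2 * (𝒯.card + 1) ≤ degIn G Finset.univ v)
    {x y z a b c : V} (hx : x ∉ 𝒯.biUnion id) (hy : y ∉ 𝒯.biUnion id) (hz : z ∉ 𝒯.biUnion id)
    (hxy : ¬ G.Adj x y) (hne : x ≠ y) (hzx : G.Adj z x) (hzy : G.Adj z y)
    (h𝒯 : ({a, b, c} : Finset V) ∈ 𝒯)
    (hxa : G.Adj x a) (hxb : G.Adj x b) (hxc : G.Adj x c) (hyb : G.Adj y b) (hyc : G.Adj y c) :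
    HasDisjointTriangles G (𝒯.card + 1) := by
  by_contra hno
  obtain ⟨hab, hac, hbc⟩ := SimpleGraph.is3Clique_triple_iff.1 (hT.clique _ h𝒯)
  have hin : ∀ v ∈ ({a, b, c} : Finset V), v ∈ 𝒯.biUnion id := fun v hv =>
    Finset.mem_biUnion.2 ⟨_, h𝒯, hv⟩
  have ha := hin a (by simp)
  have hb := hin b (by simp)
  have hc := hin c (by simp)
  have out : ∀ {u w : V}, u ∉ 𝒯.biUnion id → w ∈ 𝒯.biUnion id → u ≠ w := by
    rintro u w hu hw rfl
    exact hu hw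
  have hxa' := hxa.ne
  have hxb' := hxb.ne
  have hxc' := hxc.ne
  have hyb' := hyb.ne
  have hyc' := hyc.ne
  have hya' := out hy ha
  have hza' := out hz ha
  have hzb' := out hz hb
  have hzc' := out hz hc
  have hzx' := hzx.ne
  have hzy' := hzy.ne
  have hab' := hab.ne
  have hac' := hac.ne
  have hbc' := hbc.ne
  have two : ∀ {p q r p' q' r' : V}, G.Adj p q → G.Adj p r → G.Adj q r → G.Adj p' q' →
      G.Adj p' r' → G.Adj q' r' → Disjoint ({p, q, r} : Finset V) {p', q', r'} →
      ({p, q, r, p', q', r'} : Finset V) ⊆ {x, y, z, a, b, c} → False := by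
    intro p q r p' q' r' h1 h2 h3 h4 h5 h6 hd hs
    refine hno (hT.hasDisjointTriangles_of_two h𝒯 (isNClique_triple h1 h2 h3)
      (isNClique_triple h4 h5 h6) hd ?_ ?_ )
    all_goals
      intro v hv
      have : v ∈ ({x, y, z, a, b, c} : Finset V) := hs (by
        simp only [Finset.mem_insert, Finset.mem_singleton] at hv
        rcases hv with rfl | rfl | rfl <;> simp)
      simp only [Finset.mem_insert, Finset.mem_singleton] at this
      rcases this with rfl | rfl | rfl | rfl | rfl | rfl
      · exact Or.inr hx
      · exact Or.inr hy
      · exact Or.inr hz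
      all_goals exact Or.inl (by simp)
  -- A neighbour of `z` among `a, b, c` would split the six vertices into two triangles, one through
  -- `z` and one of `x, y`.
  have hza : ¬ G.Adj z a := fun h => two hzx h hxa hyb hyc hbc
    (by simp; grind) (by simp [Finset.insert_subset_iff])
  have hzb : ¬ G.Adj z b := fun h => two hzy h hyb hxa hxc hac
    (by simp; grind) (by simp [Finset.insert_subset_iff])
  have hzc : ¬ G.Adj z c := fun h => two hzy h hyc hxa hxb hab
    (by simp; grind) (by simp [Finset.insert_subset_iff])
  have bound : ∀ t ∈ 𝒯.erase {a, b, c}, 2 * degIn G t z + degIn G t x + degIn G t y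
      + 2 * degIn G t a ≤ 12 := fun t ht =>
    weighted_degIn_le hT hno hx hy hz hne hzx hzy h𝒯 hxa hxb hxc hyb hyc ht
  -- Weigh `z, x, y, a` by 2, 1, 1, 2. The minimum degree makes the weighted degree sum at least `12
  -- (|𝒯| + 1)`. The other triangles account for at most `12 (|𝒯| - 1)`, and the six special
  -- vertices for at most 4 + 4 + 4 + 8 = 20 < 24.
  have hsum := Finset.sum_le_sum bound
  simp only [Finset.sum_add_distrib, ← Finset.mul_sum, Finset.sum_const, smul_eq_mul] at hsum
  have huniv : Finset.univ \ 𝒯.biUnion id = {x, y, z} := by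
    symm
    refine Finset.eq_of_subset_of_card_le ?_ ?_
    · intro v hv
      simp only [Finset.mem_insert, Finset.mem_singleton] at hv
      rw [Finset.mem_sdiff]
      rcases hv with rfl | rfl | rfl <;> exact ⟨Finset.mem_univ _, by assumption⟩
    · rw [Finset.card_sdiff_of_subset (Finset.subset_univ _), hT.card_biUnion, Finset.card_univ,
        Finset.card_eq_three.2 ⟨x, y, z, hne, hzx'.symm, hzy'.symm, rfl⟩]
      omega
  have split : ∀ v, 2 * (𝒯.card + 1) ≤ degIn G {x, y, z} v + (degIn G {a, b, c} v
      + ∑ t ∈ 𝒯.erase {a, b, c}, degIn G t v) := by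
    intro v
    have h1 := hdeg v
    rw [← degIn_sdiff (Finset.subset_univ (𝒯.biUnion id)), huniv, hT.degIn_biUnion_id,
      ← Finset.add_sum_erase _ _ h𝒯] at h1
    omega
  have hsx := split x
  have hsy := split y
  have hsz := split z
  have hsa := split a
  rw [degIn_triple hne hzx'.symm hzy'.symm, degIn_triple hab' hac' hbc'] at hsx hsy hsz hsa
  have hax : ¬ G.Adj a z := fun h => hza h.symm
  have hyx : ¬ G.Adj y x := fun h => hxy h.symm
  simp only [hza, hzb, hzc, hax, hxy, hyx, SimpleGraph.irrefl, if_false] at hsx hsy hsz hsa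
  have hle : ∀ p : Prop, (if p then 1 else 0) ≤ 1 := fun p => by split_ifs <;> omega
  have l1 := hle (G.Adj x z)
  have l2 := hle (G.Adj x a)
  have l3 := hle (G.Adj x b)
  have l4 := hle (G.Adj x c)
  have l5 := hle (G.Adj y z)
  have l6 := hle (G.Adj y a)
  have l7 := hle (G.Adj y b)
  have l8 := hle (G.Adj y c)
  have l9 := hle (G.Adj z x)
  have l10 := hle (G.Adj z y)
  have l11 := hle (G.Adj a x)
  have l12 := hle (G.Adj a y)
  have l13 := hle (G.Adj a b)
  have l14 := hle (G.Adj a c)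
  have hcard' := Finset.card_erase_add_one h𝒯
  omega

end CorradiHajnal

end DensityCH

/-! ### Corrádi–Hajnal: an edge-maximal counterexample. -/

namespace DensityCH

section CorradiHajnal

open scoped Classical

variable {V : Type*} {G : SimpleGraph V}

lemma degIn_mono_left {H : SimpleGraph V} (h : G ≤ H) (A : Finset V) (v : V) :
    degIn G A v ≤ degIn H A v :=
  Finset.card_le_card (Finset.monotone_filter_right _ fun _ _ hw => h hw)

/-- If a triangle contains `x` and `y` and is complete up to the pair `x, y`, then its third vertex
is adjacent to both. -/
lemma exists_third_vertex {x y : V} (hne : x ≠ y) {t : Finset V}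
    (ht : (G ⊔ SimpleGraph.edge x y).IsNClique 3 t) (hx : x ∈ t) (hy : y ∈ t) :
    ∃ z, t = {x, y, z} ∧ z ≠ x ∧ z ≠ y ∧ G.Adj z x ∧ G.Adj z y := by
  have hc : ((t.erase x).erase y).card = 1 := by
    rw [Finset.card_erase_of_mem (Finset.mem_erase.2 ⟨hne.symm, hy⟩), Finset.card_erase_of_mem hx,
      ht.card_eq]
  obtain ⟨z, hz⟩ := Finset.card_eq_one.1 hc
  have hzm : z ∈ (t.erase x).erase y := by rw [hz]; simp
  simp only [Finset.mem_erase] at hzm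
  obtain ⟨hzy, hzx, hzt⟩ := hzm
  refine ⟨z, ?_, hzx, hzy, ?_, ?_⟩
  · rw [← hz, Finset.insert_erase (Finset.mem_erase.2 ⟨hne.symm, hy⟩), Finset.insert_erase hx]
  · have := ht.isClique hzt hx hzx
    rw [SimpleGraph.sup_adj, SimpleGraph.edge_adj] at this
    grind
  · have := ht.isClique hzt hy hzy
    rw [SimpleGraph.sup_adj, SimpleGraph.edge_adj] at this
    grind

lemma isNClique_of_sup_edge {x y : V} {t : Finset V}
    (ht : (G ⊔ SimpleGraph.edge x y).IsNClique 3 t) (h : ¬ (x ∈ t ∧ y ∈ t)) :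
    G.IsNClique 3 t := by
  refine ⟨fun a ha b hb hab => ?_, ht.card_eq⟩
  have := ht.isClique ha hb hab
  rw [SimpleGraph.sup_adj, SimpleGraph.edge_adj] at this
  have ha' : a ∈ t := ha
  have hb' : b ∈ t := hb
  grind

lemma exists_triple_of_two_le_degIn {t : Finset V} (ht : t.card = 3) {v : V}
    (h : 2 ≤ degIn G t v) : ∃ a b c, t = {a, b, c} ∧ G.Adj v b ∧ G.Adj v c := by
  unfold degIn at h
  obtain ⟨p, hp, hpc⟩ := Finset.exists_subset_card_eq h
  obtain ⟨b, c, hbc, rfl⟩ := Finset.card_eq_two.1 hpc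
  have hb := Finset.mem_filter.1 (hp (show b ∈ ({b, c} : Finset V) by simp))
  have hc := Finset.mem_filter.1 (hp (show c ∈ ({b, c} : Finset V) by simp))
  have hcs : c ∈ t.erase b := Finset.mem_erase.2 ⟨hbc.symm, hc.1⟩
  have hone : ((t.erase b).erase c).card = 1 := by
    rw [Finset.card_erase_of_mem hcs, Finset.card_erase_of_mem hb.1, ht]
  obtain ⟨a, ha⟩ := Finset.card_eq_one.1 hone
  refine ⟨a, b, c, ?_, hb.2, hc.2⟩
  rw [Finset.insert_comm, Finset.pair_comm a c, ← ha, Finset.insert_erase hcs,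
    Finset.insert_erase hb.1]

variable [Fintype V]

/-- A graph on `3 * q` vertices with minimum degree at least `2 * q` has `q` disjoint triangles. -/
theorem corradi_hajnal {q : ℕ} (hcard : Fintype.card V = 3 * q)
    (hdeg : ∀ v, 2 * q ≤ degIn G Finset.univ v) : HasDisjointTriangles G q := by
  by_contra hno
  -- In an edge-maximal counterexample, adding any missing edge `xy` creates the tiling. Its
  -- triangle through `xy` leaves an uncovered path `x z y`.
  obtain ⟨H, hH⟩ := (Set.toFinite {H : SimpleGraph V |
    (∀ v, 2 * q ≤ degIn H Finset.univ v) ∧ ¬ HasDisjointTriangles H q}).exists_maximal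
      ⟨G, hdeg, hno⟩
  obtain ⟨⟨hHdeg, hHno⟩, hmax⟩ := hH
  clear hdeg hno
  have htop : H ≠ ⊤ := by
    rintro rfl
    exact hHno (hasDisjointTriangles_top hcard.ge)
  obtain ⟨x, y, hne, hxy⟩ : ∃ x y, x ≠ y ∧ ¬ H.Adj x y := by
    by_contra hc
    push Not at hc
    exact htop (top_le_iff.1 fun a b hab => hc a b hab)
  have hbig : HasDisjointTriangles (H ⊔ SimpleGraph.edge x y) q := by
    by_contra hc
    have h1 := hmax ⟨fun v => (hHdeg v).trans (degIn_mono_left le_sup_left _ _), hc⟩ le_sup_left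
    refine hxy (h1 ?_)
    rw [SimpleGraph.sup_adj, SimpleGraph.edge_adj]
    exact Or.inr ⟨Or.inl ⟨rfl, rfl⟩, hne⟩
  obtain ⟨𝒯', h𝒯', hc⟩ := hasDisjointTriangles_iff.1 hbig
  obtain ⟨t, ht, hxt, hyt⟩ : ∃ t ∈ 𝒯', x ∈ t ∧ y ∈ t := by
    by_contra hcon
    push Not at hcon
    exact hHno (hasDisjointTriangles_iff.2 ⟨𝒯', ⟨fun t ht => isNClique_of_sup_edge
      (h𝒯'.clique t ht) (fun h => hcon t ht h.1 h.2), h𝒯'.disj⟩, hc⟩)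
  obtain ⟨z, rfl, hzx, hzy, hazx, hazy⟩ := exists_third_vertex hne (h𝒯'.clique t ht) hxt hyt
  set 𝒯 := 𝒯'.erase {x, y, z} with h𝒯def
  have hout : ∀ v ∈ ({x, y, z} : Finset V), v ∉ 𝒯.biUnion id := by
    intro v hv hv'
    obtain ⟨s, hs, hvs⟩ := Finset.mem_biUnion.1 hv'
    obtain ⟨hs1, hs2⟩ := Finset.mem_erase.1 hs
    exact Finset.disjoint_left.1 (h𝒯'.disj _ hs2 _ ht hs1) hvs hv
  have hx := hout x (by simp)
  have hy := hout y (by simp)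
  have hz := hout z (by simp)
  have hT : IsTiling H 3 𝒯 := by
    refine ⟨fun s hs => isNClique_of_sup_edge (h𝒯'.clique s (Finset.mem_of_mem_erase hs)) ?_,
      (h𝒯'.subset (Finset.erase_subset _ _)).disj⟩
    exact fun h => hx (Finset.mem_biUnion.2 ⟨s, hs, h.1⟩)
  have hq : 𝒯.card + 1 = q := by rw [← hc, h𝒯def, Finset.card_erase_add_one ht]
  subst hq
  have huniv : Finset.univ \ 𝒯.biUnion id = {x, y, z} := by
    symm
    refine Finset.eq_of_subset_of_card_le
      (fun v hv => Finset.mem_sdiff.2 ⟨Finset.mem_univ _, hout v hv⟩) ?_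
    rw [Finset.card_sdiff_of_subset (Finset.subset_univ _), hT.card_biUnion, Finset.card_univ,
      Finset.card_eq_three.2 ⟨x, y, z, hne, hzx.symm, hzy.symm, rfl⟩]
    omega
  have split : ∀ v, 2 * (𝒯.card + 1) ≤ degIn H {x, y, z} v + ∑ s ∈ 𝒯, degIn H s v := by
    intro v
    have h1 := hHdeg v
    rw [← degIn_sdiff (Finset.subset_univ (𝒯.biUnion id)), huniv, hT.degIn_biUnion_id] at h1
    omega
  -- Outside the tiling `x` and `y` are adjacent only to `z`, so together they send at least `4 (|𝒯|
  -- + 1) - 2 > 4 |𝒯|` edges into it.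
  obtain ⟨s, hs, h5⟩ : ∃ s ∈ 𝒯, 4 < degIn H s x + degIn H s y := by
    by_contra hcon
    push Not at hcon
    have h1 := Finset.sum_le_sum hcon
    rw [Finset.sum_add_distrib, Finset.sum_const, smul_eq_mul] at h1
    have hsx := split x
    have hsy := split y
    have hyx : ¬ H.Adj y x := fun h => hxy h.symm
    rw [degIn_triple hne hzx.symm hzy.symm] at hsx hsy
    simp only [hxy, hyx, SimpleGraph.irrefl, hazx.symm, hazy.symm, if_false, if_true] at hsx hsy
    omega
  /- the vertex with three neighbours in `s` is put first -/
  have key : ∀ x' y' : V, x' ∉ 𝒯.biUnion id → y' ∉ 𝒯.biUnion id → ¬ H.Adj x' y' → x' ≠ y' →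
      H.Adj z x' → H.Adj z y' → degIn H s x' = 3 → 2 ≤ degIn H s y' → False := by
    intro x' y' hx' hy' hxy' hne' hzx' hzy' h3 h2
    have hs3 := (hT.clique s hs).card_eq
    have hall : ∀ w ∈ s, H.Adj x' w := by
      rw [← degIn_eq_card_iff, h3, hs3]
    obtain ⟨a, b, c, hs_eq, hb, hc⟩ := exists_triple_of_two_le_degIn hs3 h2
    subst hs_eq
    exact hHno (exists_perfect_tiling_of_path hT hcard hHdeg hx' hy' hz hxy' hne' hzx' hzy' hs
      (hall a (by simp)) (hall b (by simp)) (hall c (by simp)) hb hc)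
  have hlx := degIn_le_card (G := H) s x
  have hly := degIn_le_card (G := H) s y
  rw [(hT.clique s hs).card_eq] at hlx hly
  rcases Nat.lt_or_ge (degIn H s x) 3 with h | h
  · exact key y x hy hx (fun h => hxy h.symm) hne.symm hazy hazx (by omega) (by omega)
  · exact key x y hx hy hxy hne hazx hazy (by omega) (by omega)

/-- A set of `3 * q` vertices that each have at least `2 * q` neighbours in it contains `q` disjoint
triangles. -/
lemma hasDisjointTriangles_of_degIn {q : ℕ} {W : Finset V} (hW : W.card = 3 * q)
    (hdeg : ∀ v ∈ W, 2 * q ≤ degIn G W v) : HasDisjointTriangles G q := by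
  refine hasDisjointTriangles_of_induce (s := (W : Set V)) (corradi_hajnal ?_ fun v => ?_)
  · simpa using hW
  · rw [degIn_induce]
    exact hdeg v v.2

end CorradiHajnal

end DensityCH

/-! ### The sparse regime: a tiling with a largest matching outside it. -/

namespace DensityCH

/-- A tiling `𝒯` by `k` triangles and a matching `M` outside of it. -/
structure IsTilingWithMatching {V : Type*} (G : SimpleGraph V) (k : ℕ)
    (𝒯 M : Finset (Finset V)) : Prop where
  tiling : IsTiling G 3 𝒯
  card_eq : 𝒯.card = k
  matching : IsTiling G 2 M
  not_mem : ∀ f ∈ M, ∀ v ∈ f, ∀ t ∈ 𝒯, v ∉ t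

section Sparse

open scoped Classical

variable {V : Type*} {G : SimpleGraph V} {k : ℕ} {𝒯 M : Finset (Finset V)}

namespace IsTilingWithMatching

lemma not_mem_biUnion (h : IsTilingWithMatching G k 𝒯 M) {f : Finset V} (hf : f ∈ M) {v : V}
    (hv : v ∈ f) : v ∉ 𝒯.biUnion id := by
  intro hv'
  obtain ⟨t, ht, hvt⟩ := Finset.mem_biUnion.1 hv'
  exact h.not_mem f hf v hv t ht hvt

lemma sum_degIn_edge_le_six (h : IsTilingWithMatching G k 𝒯 M) {t f : Finset V} (ht : t ∈ 𝒯)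
    (hf : f ∈ M) : ∑ v ∈ f, degIn G t v ≤ 6 := by
  have h1 : ∀ v ∈ f, degIn G t v ≤ 3 := fun v _ =>
    (degIn_le_card t v).trans (h.tiling.clique t ht).card_eq.le
  simpa [(h.matching.clique f hf).card_eq] using Finset.sum_le_card_nsmul f _ 3 h1

/-- A larger matching is obtained from an edge between two unmatched vertices. -/
lemma insert_edge (h : IsTilingWithMatching G k 𝒯 M) {u v : V} (huv : G.Adj u v)
    (hu : u ∉ 𝒯.biUnion id) (hv : v ∉ 𝒯.biUnion id) (huM : u ∉ M.biUnion id)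
    (hvM : v ∉ M.biUnion id) :
    ∃ M', IsTilingWithMatching G k 𝒯 M' ∧ M'.card = M.card + 1 := by
  have hp := isNClique_pair huv
  have hd : ∀ s ∈ ({{u, v}} : Finset (Finset V)), ∀ f ∈ M, Disjoint s f := by
    intro s hs f hf
    rw [Finset.mem_singleton] at hs
    subst hs
    rw [Finset.disjoint_left]
    intro w hw hwf
    have : w ∈ M.biUnion id := Finset.mem_biUnion.2 ⟨f, hf, hwf⟩
    simp only [Finset.mem_insert, Finset.mem_singleton] at hw
    rcases hw with rfl | rfl <;> contradiction
  refine ⟨M ∪ {{u, v}}, ⟨h.tiling, h.card_eq, h.matching.union (IsTiling.singleton hp) hd, ?_⟩, ?_⟩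
  · intro f hf w hw t ht hwt
    rcases Finset.mem_union.1 hf with hf | hf
    · exact h.not_mem f hf w hw t ht hwt
    · rw [Finset.mem_singleton] at hf
      subst hf
      have : w ∈ 𝒯.biUnion id := Finset.mem_biUnion.2 ⟨t, ht, hwt⟩
      simp only [Finset.mem_insert, Finset.mem_singleton] at hw
      rcases hw with rfl | rfl <;> contradiction
  · rw [IsTiling.card_union (by norm_num) (IsTiling.singleton hp) hd, Finset.card_singleton]

end IsTilingWithMatching

variable [Fintype V]

lemma IsTiling.not_adj_of_not_mem (hT : IsTiling G 3 𝒯)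
    (hno : ¬ HasDisjointTriangles G (𝒯.card + 1)) {u v w : V} (hu : u ∉ 𝒯.biUnion id)
    (hv : v ∉ 𝒯.biUnion id) (hw : w ∉ 𝒯.biUnion id) (huv : G.Adj u v) (huw : G.Adj u w) :
    ¬ G.Adj v w := by
  intro hvw
  refine hno (hT.hasDisjointTriangles_of_replace (Finset.empty_subset _)
    (IsTiling.singleton (isNClique_triple huv huw hvw)) ?_ (by simp))
  intro s hs x hx
  rw [Finset.mem_singleton] at hs
  subst hs
  simp only [Finset.mem_insert, Finset.mem_singleton] at hx
  rcases hx with rfl | rfl | rfl <;> exact Or.inr (by assumption)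

namespace IsTilingWithMatching

/-- Two vertices of a triangle cannot complete two different edges of the matching. -/
lemma not_complete (h : IsTilingWithMatching G k 𝒯 M) (hno : ¬ HasDisjointTriangles G (k + 1))
    {t f g : Finset V} (ht : t ∈ 𝒯) (hf : f ∈ M) (hg : g ∈ M) (hfg : f ≠ g) {x y : V}
    (hx : x ∈ t) (hy : y ∈ t) (hxy : x ≠ y) (hxf : degIn G f x = 2) : degIn G g y ≠ 2 := by
  intro hyg
  rw [← (h.matching.clique f hf).card_eq, degIn_eq_card_iff] at hxf
  rw [← (h.matching.clique g hg).card_eq, degIn_eq_card_iff] at hyg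
  have h1 := (h.matching.clique f hf).insert hxf
  have h2 := (h.matching.clique g hg).insert hyg
  refine hno (h.card_eq ▸ h.tiling.hasDisjointTriangles_of_two ht h1 h2 ?_ ?_ ?_)
  · rw [Finset.disjoint_left]
    intro v hv hv'
    rcases Finset.mem_insert.1 hv with rfl | hv <;> rcases Finset.mem_insert.1 hv' with rfl | hv'
    · exact hxy rfl
    · exact h.not_mem g hg v hv' t ht hx
    · exact h.not_mem f hf v hv t ht hy
    · exact Finset.disjoint_left.1 (h.matching.disj f hf g hg hfg) hv hv'
  · intro v hv
    rcases Finset.mem_insert.1 hv with rfl | hv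
    exacts [Or.inl hx, Or.inr (h.not_mem_biUnion hf hv)]
  · intro v hv
    rcases Finset.mem_insert.1 hv with rfl | hv
    exacts [Or.inl hy, Or.inr (h.not_mem_biUnion hg hv)]

/-- Count from the side of `t`: a vertex has two neighbours in a matching edge exactly when it
completes that edge to a triangle. If only one vertex of `t` completes edges, each edge gets at most
2 + 1 + 1. If two do, `not_complete` forces them to complete one common edge and nothing else, so
every other edge gets at most 1 + 1 + 1. -/
lemma sum_degIn_edge_le (h : IsTilingWithMatching G k 𝒯 M)
    (hno : ¬ HasDisjointTriangles G (k + 1)) {t : Finset V} (ht : t ∈ 𝒯) :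
    (∀ f ∈ M, ∑ v ∈ f, degIn G t v ≤ 4) ∨
      ∃ g ∈ M, ∀ f ∈ M, f ≠ g → ∑ v ∈ f, degIn G t v ≤ 3 := by
  have ht3 := (h.tiling.clique t ht).card_eq
  have hle : ∀ f ∈ M, ∀ x, degIn G f x ≤ 2 := fun f hf x =>
    (degIn_le_card f x).trans (h.matching.clique f hf).card_eq.le
  have hthree : ∀ f, (∀ x ∈ t, degIn G f x ≤ 1) → ∑ v ∈ f, degIn G t v ≤ 3 := by
    intro f hf
    rw [sum_degIn_comm]
    simpa [ht3] using Finset.sum_le_card_nsmul t _ 1 hf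
  by_cases hc : ∃ x ∈ t, ∃ g ∈ M, degIn G g x = 2
  swap
  · push Not at hc
    refine Or.inl fun f hf => (hthree f fun x hx => ?_).trans (by norm_num)
    have h1 := hle f hf x
    have h2 := hc x hx f hf
    omega
  obtain ⟨x, hx, g, hg, hxg⟩ := hc
  by_cases hc2 : ∃ y ∈ t, y ≠ x ∧ ∃ f ∈ M, degIn G f y = 2
  · obtain ⟨y, hy, hyx, f₀, hf₀, hyf₀⟩ := hc2
    have hfg : f₀ = g := by
      by_contra hne
      exact h.not_complete hno ht hg hf₀ (Ne.symm hne) hx hy hyx.symm hxg hyf₀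
    subst hfg
    refine Or.inr ⟨f₀, hf₀, fun f hf hne => hthree f fun w hw => ?_⟩
    have h1 := hle f hf w
    have h2 : degIn G f w ≠ 2 := by
      by_cases hwx : w = x
      · subst hwx
        exact h.not_complete hno ht hf₀ hf (Ne.symm hne) hy hw hyx hyf₀
      · exact h.not_complete hno ht hf₀ hf (Ne.symm hne) hx hw (Ne.symm hwx) hxg
    omega
  · push Not at hc2
    refine Or.inl fun f hf => ?_
    rw [sum_degIn_comm, ← Finset.add_sum_erase _ _ hx]
    have h1 := hle f hf x
    have h2 : ∑ y ∈ t.erase x, degIn G f y ≤ 2 := by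
      have : ∀ y ∈ t.erase x, degIn G f y ≤ 1 := by
        intro y hy
        have h3 := hle f hf y
        have h4 := hc2 y (Finset.mem_of_mem_erase hy) (Finset.ne_of_mem_erase hy) f hf
        omega
      simpa [Finset.card_erase_of_mem hx, ht3] using Finset.sum_le_card_nsmul _ _ 1 this
    omega

/-- A vertex outside of `t ∪ f` has at most one neighbour in `t`, if `t ∪ f` is complete. -/
lemma degIn_le_one (h : IsTilingWithMatching G k 𝒯 M) (hno : ¬ HasDisjointTriangles G (k + 1))
    {t f : Finset V} (ht : t ∈ 𝒯) (hf : f ∈ M) (h6 : 6 ≤ ∑ v ∈ f, degIn G t v) {u : V}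
    (hu : u ∉ 𝒯.biUnion id) (huf : u ∉ f) : degIn G t u ≤ 1 := by
  by_contra hlt
  have htc := h.tiling.clique t ht
  obtain ⟨a, b, c, rfl, hub, huc⟩ := exists_triple_of_two_le_degIn htc.card_eq
    (show 2 ≤ degIn G t u by omega)
  obtain ⟨hab, hac, hbc⟩ := SimpleGraph.is3Clique_triple_iff.1 htc
  have hfull : ∀ v ∈ f, G.Adj a v := by
    rw [← degIn_eq_card_iff, (h.matching.clique f hf).card_eq]
    rw [sum_degIn_comm, Finset.sum_insert (by simp [hab.ne, hac.ne]), Finset.sum_pair hbc.ne] at h6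
    have hle : ∀ x, degIn G f x ≤ 2 := fun x =>
      (degIn_le_card f x).trans (h.matching.clique f hf).card_eq.le
    have h1 := hle a
    have h2 := hle b
    have h3 := hle c
    omega
  have hmem : ∀ v ∈ ({a, b, c} : Finset V), v ∈ 𝒯.biUnion id := fun v hv =>
    Finset.mem_biUnion.2 ⟨_, ht, hv⟩
  refine hno (h.card_eq ▸ h.tiling.hasDisjointTriangles_of_two ht
    (isNClique_triple hub huc hbc) ((h.matching.clique f hf).insert hfull) ?_ ?_ ?_)
  · rw [Finset.disjoint_left]
    intro v hv hv'
    simp only [Finset.mem_insert, Finset.mem_singleton] at hv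
    rcases hv with rfl | rfl | rfl <;> rcases Finset.mem_insert.1 hv' with h' | hv'
    · subst h'
      exact hu (hmem _ (by simp))
    · exact huf hv'
    · exact hab.ne h'.symm
    · exact h.not_mem f hf _ hv' _ ht (by simp)
    · exact hac.ne h'.symm
    · exact h.not_mem f hf _ hv' _ ht (by simp)
  · intro v hv
    simp only [Finset.mem_insert, Finset.mem_singleton] at hv
    rcases hv with rfl | rfl | rfl
    · exact Or.inr hu
    · exact Or.inl (by simp)
    · exact Or.inl (by simp)
  · intro v hv
    rcases Finset.mem_insert.1 hv with rfl | hv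
    exacts [Or.inl (by simp), Or.inr (h.not_mem_biUnion hf hv)]

/-- If the matching is maximum and the unmatched vertex `u` is joined to all of the triangle `t`,
then no other unmatched vertex has a neighbour in `t`. -/
lemma degIn_eq_zero (h : IsTilingWithMatching G k 𝒯 M)
    (hmax : ∀ 𝒯' M', IsTilingWithMatching G k 𝒯' M' → M'.card ≤ M.card)
    {t : Finset V} (ht : t ∈ 𝒯) {u u' : V} (hu : u ∉ 𝒯.biUnion id) (huM : u ∉ M.biUnion id)
    (hu' : u' ∉ 𝒯.biUnion id) (hu'M : u' ∉ M.biUnion id) (hne : u ≠ u')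
    (h3 : degIn G t u = 3) : degIn G t u' = 0 := by
  have htc := h.tiling.clique t ht
  have hall : ∀ w ∈ t, G.Adj u w := by rw [← degIn_eq_card_iff, h3, htc.card_eq]
  rw [degIn_eq_zero_iff]
  intro x hx hadj
  have hxU : x ∈ 𝒯.biUnion id := Finset.mem_biUnion.2 ⟨t, ht, hx⟩
  have hclique : G.IsNClique 3 (insert u (t.erase x)) := by
    refine SimpleGraph.IsNClique.insert (n := 2) ⟨htc.isClique.subset ?_, ?_⟩ ?_
    · exact_mod_cast Finset.erase_subset x t
    · rw [Finset.card_erase_of_mem hx, htc.card_eq]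
    · exact fun w hw => hall w (Finset.mem_of_mem_erase hw)
  obtain ⟨h1, h2⟩ := h.tiling.exists_replace (by norm_num) (𝒮 := {t}) (by simpa using ht)
    (IsTiling.singleton hclique) (by
      intro s hs w hw
      rw [Finset.mem_singleton] at hs
      subst hs
      rcases Finset.mem_insert.1 hw with rfl | hw
      · exact Or.inr hu
      · exact Or.inl (by simpa using Finset.mem_of_mem_erase hw))
  set 𝒯' := 𝒯 \ {t} ∪ {insert u (t.erase x)} with h𝒯'
  have hmem : ∀ w, w ∈ 𝒯'.biUnion id → w = u ∨ (w ∈ 𝒯.biUnion id ∧ w ≠ x) := by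
    intro w hw
    obtain ⟨s, hs, hws⟩ := Finset.mem_biUnion.1 hw
    simp only [id] at hws
    rcases Finset.mem_union.1 hs with hs' | hs'
    · rw [Finset.mem_sdiff, Finset.mem_singleton] at hs'
      refine Or.inr ⟨Finset.mem_biUnion.2 ⟨s, hs'.1, hws⟩, ?_⟩
      rintro rfl
      exact Finset.disjoint_left.1 (h.tiling.disj s hs'.1 t ht hs'.2) hws hx
    · rw [Finset.mem_singleton] at hs'
      subst hs'
      rcases Finset.mem_insert.1 hws with rfl | hws
      · exact Or.inl rfl
      · exact Or.inr ⟨Finset.mem_biUnion.2 ⟨t, ht, Finset.mem_of_mem_erase hws⟩,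
          Finset.ne_of_mem_erase hws⟩
  have hnew : IsTilingWithMatching G k 𝒯' M := by
    refine ⟨h1, ?_, h.matching, ?_⟩
    · simp only [Finset.card_singleton] at h2
      have := h.card_eq
      omega
    · intro f hf w hw s hs hws
      rcases hmem w (Finset.mem_biUnion.2 ⟨s, hs, hws⟩) with rfl | h'
      · exact huM (Finset.mem_biUnion.2 ⟨f, hf, hw⟩)
      · exact h.not_mem_biUnion hf hw h'.1
  have h₁ : u' ∉ 𝒯'.biUnion id := fun hc => by
    rcases hmem _ hc with rfl | h'
    exacts [hne rfl, hu' h'.1]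
  have h₂ : x ∉ 𝒯'.biUnion id := fun hc => by
    rcases hmem _ hc with rfl | h'
    exacts [hu hxU, h'.2 rfl]
  have h₃ : x ∉ M.biUnion id := fun hc => by
    obtain ⟨f, hf, hxf⟩ := Finset.mem_biUnion.1 hc
    exact h.not_mem_biUnion hf hxf hxU
  obtain ⟨M', hM', hcard⟩ := hnew.insert_edge hadj h₁ h₂ hu'M h₃
  have := hmax _ _ hM'
  omega

end IsTilingWithMatching

/-- A graph in which all degrees exceed half the number of vertices, and all triangles have large
degree sum, has one more disjoint triangle than required by a given tiling. -/
theorem hasDisjointTriangles_succ_of_sparse (hn : 4 * k + 3 ≤ Fintype.card V)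
    (hdeg : ∀ v, Fintype.card V / 2 + 1 ≤ degIn G Finset.univ v)
    (htri : ∀ u v w, G.Adj u v → G.Adj u w → G.Adj v w → 2 * Fintype.card V + k ≤
      degIn G Finset.univ u + degIn G Finset.univ v + degIn G Finset.univ w)
    (hk : HasDisjointTriangles G k) : HasDisjointTriangles G (k + 1) := by
  by_contra hno
  obtain ⟨𝒯₀, h𝒯₀, hc₀⟩ := hasDisjointTriangles_iff.1 hk
  obtain ⟨⟨𝒯, M⟩, hTM, hmax⟩ := Finset.exists_max_image
    (Finset.univ.filter fun p : Finset (Finset V) × Finset (Finset V) =>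
      IsTilingWithMatching G k p.1 p.2) (fun p => p.2.card)
    ⟨(𝒯₀, ∅), Finset.mem_filter.2 ⟨Finset.mem_univ _, h𝒯₀, hc₀, IsTiling.empty, by simp⟩⟩
  have h : IsTilingWithMatching G k 𝒯 M := (Finset.mem_filter.1 hTM).2
  replace hmax : ∀ 𝒯' M', IsTilingWithMatching G k 𝒯' M' → M'.card ≤ M.card := fun 𝒯' M' h' =>
    hmax (𝒯', M') (Finset.mem_filter.2 ⟨Finset.mem_univ _, h'⟩)
  clear hTM
  set n := Fintype.card V with hndef
  set U := 𝒯.biUnion id with hU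
  set S := M.biUnion id with hS
  have hUcard : U.card = 3 * k := by rw [hU, h.tiling.card_biUnion, h.card_eq]
  have hScard : S.card = 2 * M.card := by rw [hS, h.matching.card_biUnion]
  set R := Finset.univ \ U with hR
  have hSR : S ⊆ R := by
    intro v hv
    obtain ⟨f, hf, hvf⟩ := Finset.mem_biUnion.1 hv
    exact Finset.mem_sdiff.2 ⟨Finset.mem_univ _, h.not_mem_biUnion hf hvf⟩
  set I := R \ S with hI
  have hRcard : R.card + 3 * k = n := by
    have := Finset.card_sdiff_add_card_eq_card (Finset.subset_univ U)
    rw [hUcard, Finset.card_univ] at this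
    exact this
  have hIcard : I.card + 2 * M.card = R.card := by
    have := Finset.card_sdiff_add_card_eq_card hSR
    rw [hScard] at this
    exact this
  have hno' : ¬ HasDisjointTriangles G (𝒯.card + 1) := by rwa [h.card_eq]
  have hRU : ∀ v ∈ R, v ∉ U := fun v hv => (Finset.mem_sdiff.1 hv).2
  have hRtri : ∀ u ∈ R, ∀ v ∈ R, ∀ w ∈ R, G.Adj u v → G.Adj u w → ¬ G.Adj v w :=
    fun u hu v hv w hw => h.tiling.not_adj_of_not_mem hno' (hRU u hu) (hRU v hv) (hRU w hw)
  have hsplit : ∀ v, degIn G Finset.univ v = (∑ t ∈ 𝒯, degIn G t v) + degIn G R v := fun v => by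
    rw [← h.tiling.degIn_biUnion_id, ← hU, hR, degIn_sdiff (Finset.subset_univ U)]
  -- edges between the matching and the tiling
  have hedge : ∀ f ∈ M, 4 * k + 1 ≤ ∑ v ∈ f, ∑ t ∈ 𝒯, degIn G t v := by
    intro f hf
    obtain ⟨u, v, huv, rfl⟩ := Finset.card_eq_two.1 (h.matching.clique f hf).card_eq
    have hadj : G.Adj u v := (h.matching.clique _ hf).isClique (by simp) (by simp) huv
    have huR : u ∈ R := hSR (Finset.mem_biUnion.2 ⟨_, hf, by simp⟩)
    have hvR : v ∈ R := hSR (Finset.mem_biUnion.2 ⟨_, hf, by simp⟩)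
    have hdu := hdeg u
    have hdv := hdeg v
    -- The edge `uv` lies in a triangle `uvw`. From `d(w) ≤ n - 1` follows `d(u) + d(v) ≥ n + k +
    -- 1`, and at most `|R| = n - 3k` of this stays in the triangle-free `R`.
    obtain ⟨w, -, huw, hvw⟩ := exists_common_of_card_lt (G := G) (A := Finset.univ) (u := u) (v := v)
      (by rw [Finset.card_univ]; omega)
    have hsum := htri u v w hadj huw hvw
    have hw := degIn_lt_card (G := G) (Finset.mem_univ w)
    rw [Finset.card_univ] at hw
    have hle : degIn G R u + degIn G R v ≤ R.card := degIn_add_degIn_le fun x hx hux hvx =>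
      hRtri u huR v hvR x hx hadj hux hvx
    rw [Finset.sum_pair huv]
    have h1 := hsplit u
    have h2 := hsplit v
    omega
  have hp : M.card * (4 * k + 1) ≤ ∑ t ∈ 𝒯, ∑ f ∈ M, ∑ v ∈ f, degIn G t v := by
    have h1 := Finset.card_nsmul_le_sum M _ _ hedge
    rw [smul_eq_mul] at h1
    refine h1.trans (le_of_eq ?_)
    rw [Finset.sum_comm (s := 𝒯)]
    exact Finset.sum_congr rfl fun f _ => Finset.sum_comm
  -- edges between the unmatched vertices and the tiling
  have hIM : ∀ u ∈ I, u ∉ U ∧ u ∉ S := fun u hu =>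
    ⟨hRU u (Finset.mem_sdiff.1 hu).1, (Finset.mem_sdiff.1 hu).2⟩
  have hIdeg : ∀ u ∈ I, n / 2 + 1 - M.card ≤ ∑ t ∈ 𝒯, degIn G t u := by
    intro u hu
    -- By maximality of `M`, the unmatched vertices are independent.
    have h1 : degIn G I u = 0 := by
      rw [degIn_eq_zero_iff]
      intro v hv hadj
      obtain ⟨M', hM', hc⟩ := h.insert_edge hadj (hIM u hu).1 (hIM v hv).1 (hIM u hu).2 (hIM v hv).2
      have := hmax _ _ hM'
      omega
    have h2 : degIn G S u ≤ M.card := by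
      rw [hS, h.matching.degIn_biUnion_id]
      refine (Finset.sum_le_card_nsmul M _ 1 fun f hf => ?_).trans (by simp)
      by_contra hlt
      have hf2 := (h.matching.clique f hf).card_eq
      have hle := degIn_le_card (G := G) f u
      have hfull := (degIn_eq_card_iff (G := G) f u).1 (by omega)
      obtain ⟨v, w, hvw, rfl⟩ := Finset.card_eq_two.1 hf2
      exact hRtri u (Finset.mem_sdiff.1 hu).1 v (hSR (Finset.mem_biUnion.2 ⟨_, hf, by simp⟩)) w
        (hSR (Finset.mem_biUnion.2 ⟨_, hf, by simp⟩)) (hfull v (by simp)) (hfull w (by simp))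
        ((h.matching.clique _ hf).isClique (by simp) (by simp) hvw)
    have h3 := degIn_sdiff (G := G) hSR u
    rw [← hI] at h3
    have h4 := hsplit u
    have h5 := hdeg u
    omega
  have hq : I.card * (n / 2 + 1 - M.card) ≤ ∑ t ∈ 𝒯, ∑ u ∈ I, degIn G t u := by
    have h1 := Finset.card_nsmul_le_sum I _ _ hIdeg
    rwa [smul_eq_mul, Finset.sum_comm] at h1
  -- If one unmatched vertex sees all of `t`, the others see nothing of it by `degIn_eq_zero`, and
  -- the sum is 3; otherwise each sees at most two vertices.
  have hq2 : ∀ t ∈ 𝒯, ∑ u ∈ I, degIn G t u ≤ 2 * I.card + 1 := by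
    intro t ht
    by_cases hc : ∃ u ∈ I, degIn G t u = 3
    · obtain ⟨u, hu, h3⟩ := hc
      rw [← Finset.add_sum_erase _ _ hu, h3, Finset.sum_eq_zero]
      · have := Finset.card_pos.2 ⟨u, hu⟩
        omega
      · intro u' hu'
        have hu'I := Finset.mem_of_mem_erase hu'
        exact h.degIn_eq_zero hmax ht (hIM u hu).1 (hIM u hu).2 (hIM u' hu'I).1 (hIM u' hu'I).2
          (Finset.ne_of_mem_erase hu').symm h3
    · push Not at hc
      have : ∀ u ∈ I, degIn G t u ≤ 2 := by
        intro u hu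
        have h1 := degIn_le_card (G := G) t u
        have h2 := hc u hu
        rw [(h.tiling.clique t ht).card_eq] at h1
        omega
      have : ∑ u ∈ I, degIn G t u ≤ I.card • 2 := Finset.sum_le_card_nsmul _ _ _ this
      rw [smul_eq_mul] at this
      omega
  have hp2 : ∀ t ∈ 𝒯, ∑ f ∈ M, ∑ v ∈ f, degIn G t v ≤ 4 * M.card ∨
      ∃ g ∈ M, ∑ f ∈ M, ∑ v ∈ f, degIn G t v + 3 ≤ 3 * M.card + ∑ v ∈ g, degIn G t v := by
    intro t ht
    rcases h.sum_degIn_edge_le hno ht with h4 | ⟨g, hg, h3⟩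
    · left
      have := Finset.sum_le_card_nsmul _ _ _ h4
      rwa [smul_eq_mul, mul_comm] at this
    · right
      refine ⟨g, hg, ?_⟩
      rw [← Finset.add_sum_erase _ _ hg]
      have := Finset.sum_le_card_nsmul (M.erase g) _ 3 fun f hf =>
        h3 f (Finset.mem_of_mem_erase hf) (Finset.ne_of_mem_erase hf)
      rw [smul_eq_mul] at this
      have := Finset.card_erase_add_one hg
      omega
  -- For `|M| ≥ 3` also the exceptional alternative satisfies `3 (|M| - 1) + 6 ≤ 4 |M|`, so the
  -- tiling receives at most `4k |M|` edges, too few for `|M| (4k + 1)`.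
  rcases Nat.lt_or_ge 2 M.card with hm | hm
  · have : ∀ t ∈ 𝒯, ∑ f ∈ M, ∑ v ∈ f, degIn G t v ≤ 4 * M.card := by
      intro t ht
      rcases hp2 t ht with h1 | ⟨g, hg, h1⟩
      · exact h1
      · have := h.sum_degIn_edge_le_six ht hg
        omega
    have h1 := hp.trans (Finset.sum_le_card_nsmul _ _ _ this)
    rw [h.card_eq, smul_eq_mul] at h1
    nlinarith
  rcases Nat.lt_or_ge 1 M.card with hm1 | hm1
  · have hm2 : M.card = 2 := by omega
    rw [hm2] at hp hq hp2 hIcard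
    -- For `|M| = 2` at least two triangles receive all 9 possible edges. One matching edge is then
    -- completely joined to such a triangle, and `degIn_le_one` costs `|I| + 1` against the bound `2
    -- |I| + 1`. This gives `2 |I| + 2 ≤ k`, although `|I| ≥ k - 1`.
    set 𝒩 := 𝒯.filter fun t => 9 ≤ ∑ f ∈ M, ∑ v ∈ f, degIn G t v with h𝒩
    have h8 : ∑ t ∈ 𝒯, ∑ f ∈ M, ∑ v ∈ f, degIn G t v ≤ 8 * k + 𝒩.card := by
      have : ∀ t ∈ 𝒯, ∑ f ∈ M, ∑ v ∈ f, degIn G t v ≤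
          8 + if 9 ≤ ∑ f ∈ M, ∑ v ∈ f, degIn G t v then 1 else 0 := by
        intro t ht
        rcases hp2 t ht with h1 | ⟨g, hg, h1⟩
        · omega
        · have := h.sum_degIn_edge_le_six ht hg
          split_ifs <;> omega
      have h1 := Finset.sum_le_sum this
      rw [Finset.sum_add_distrib, Finset.sum_const, h.card_eq, smul_eq_mul, ← Finset.card_filter]
        at h1
      change _ ≤ k * 8 + 𝒩.card at h1
      omega
    have h2 : ∑ t ∈ 𝒯, ∑ u ∈ I, degIn G t u + 𝒩.card * (I.card + 1) ≤ k * (2 * I.card + 1) := by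
      have : ∀ t ∈ 𝒯, ∑ u ∈ I, degIn G t u +
          (if 9 ≤ ∑ f ∈ M, ∑ v ∈ f, degIn G t v then I.card + 1 else 0) ≤ 2 * I.card + 1 := by
        intro t ht
        split_ifs with h9
        · rcases hp2 t ht with h1 | ⟨g, hg, h1⟩
          · omega
          · have h6 := h.sum_degIn_edge_le_six ht hg
            have : ∀ u ∈ I, degIn G t u ≤ 1 := fun u hu =>
              h.degIn_le_one hno ht hg (by omega) (hIM u hu).1
                fun hug => (hIM u hu).2 (Finset.mem_biUnion.2 ⟨g, hg, hug⟩)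
            have : ∑ u ∈ I, degIn G t u ≤ I.card • 1 := Finset.sum_le_card_nsmul _ _ _ this
            rw [smul_eq_mul] at this
            omega
        · exact hq2 t ht
      have h1 := Finset.sum_le_sum this
      rwa [Finset.sum_add_distrib, Finset.sum_const, h.card_eq, smul_eq_mul, ← Finset.sum_filter,
        Finset.sum_const, smul_eq_mul] at h1
    have h3 : 2 ≤ 𝒩.card := by omega
    have h4 : I.card * (2 * k) ≤ I.card * (n / 2 + 1 - 2) := Nat.mul_le_mul_left _ (by omega)
    nlinarith
  -- For `|M| ≤ 1` the count from `I` suffices: it gives `2 |I| ≤ k` if `|M| = 0` and `|I| ≤ k` if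
  -- `|M| = 1`, while `|I| = n - 3k - 2 |M|` is at least `k + 3` and `k + 1` respectively.
  · have h1 := hq.trans (Finset.sum_le_card_nsmul _ _ _ hq2)
    rw [h.card_eq, smul_eq_mul] at h1
    have h2 : I.card * (2 * k + 2 - M.card) ≤ I.card * (n / 2 + 1 - M.card) :=
      Nat.mul_le_mul_left _ (by omega)
    interval_cases hM : M.card
    · have h4 : I.card * (2 * k + 2) ≤ k * (2 * I.card + 1) := h2.trans h1
      nlinarith
    · have h4 : I.card * (2 * k + 1) ≤ k * (2 * I.card + 1) := h2.trans h1
      nlinarith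

end Sparse

end DensityCH

/-! ### The dense regime: vertices that lie in no triangle. -/

namespace DensityCH

section Dense

open scoped Classical

variable {V : Type*} {G : SimpleGraph V}

lemma erase_erase_union {L H : Finset V} (hLH : Disjoint L H) {v w : V} (hv : v ∈ L)
    (hw : w ∈ H) : ((L ∪ H).erase v).erase w = L.erase v ∪ H.erase w := by
  have h1 : v ∉ H := Finset.disjoint_left.1 hLH hv
  have h2 : w ∉ L := Finset.disjoint_right.1 hLH hw
  rw [Finset.erase_union_distrib, Finset.erase_eq_of_notMem h1, Finset.erase_union_distrib,
    Finset.erase_eq_of_notMem (fun h => h2 (Finset.mem_of_mem_erase h))]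

/-- If no vertex of `L` is in a triangle, then at most `C(|H|, 2) + C(|L| + 1, 2)` edges lie in
`L ∪ H`. -/
lemma degSum_union_le {L H : Finset V} (hLH : Disjoint L H)
    (hL : ∀ v ∈ L, ∀ w ∈ L ∪ H, ∀ x ∈ L ∪ H, G.Adj v w → G.Adj v x → ¬ G.Adj w x) :
    degSum G (L ∪ H) + H.card ≤ H.card * H.card + L.card * (L.card + 1) := by
  induction hl : L.card generalizing L H with
  | zero =>
    have h1 := degSum_le (G := G) (L ∪ H)
    rw [Finset.card_eq_zero.1 hl, Finset.empty_union] at h1 ⊢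
    rcases Nat.eq_zero_or_pos H.card with h0 | h0
    · simp only [h0, Nat.zero_mul, Nat.zero_add, Nat.add_zero] at h1 ⊢
      omega
    · obtain ⟨m, hm⟩ := Nat.exists_eq_add_of_lt h0
      rw [hm] at h1 ⊢
      simp only [Nat.zero_add, Nat.add_sub_cancel] at h1 ⊢
      nlinarith
  | succ l ih =>
    -- The ends of an edge at `L` have no common neighbour, so deleting both loses at most `|L| +
    -- |H| - 1` edges. For an edge from `L` to `H` the bound drops by exactly this much.
    by_cases hc : ∃ v ∈ L, ∃ w ∈ H, G.Adj v w
    · obtain ⟨v, hv, w, hw, hvw⟩ := hc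
      have hvA : v ∈ L ∪ H := Finset.mem_union_left _ hv
      have hwA : w ∈ L ∪ H := Finset.mem_union_right _ hw
      have hLs : L.erase v ⊆ L := Finset.erase_subset _ _
      have hsub : L.erase v ∪ H.erase w ⊆ L ∪ H :=
        Finset.union_subset_union hLs (Finset.erase_subset _ _)
      have h1 := ih (L := L.erase v) (H := H.erase w)
        (hLH.mono hLs (Finset.erase_subset _ _))
        (fun a ha b hb c hc => hL a (hLs ha) b (hsub hb) c (hsub hc))
        (by rw [Finset.card_erase_of_mem hv, hl]; rfl)
      have h2 := degSum_erase_edge hvA hwA hvw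
      rw [erase_erase_union hLH hv hw] at h2
      have h3 : degIn G (L ∪ H) v + degIn G (L ∪ H) w ≤ (L ∪ H).card :=
        degIn_add_degIn_le fun x hx hvx hwx => hL v hv w hwA x hx hvw hvx hwx
      rw [Finset.card_union_of_disjoint hLH, hl] at h3
      have h4 := Finset.card_erase_add_one hw
      rw [← h4] at h3 ⊢
      nlinarith
    · push Not at hc
      have h1 : ∀ v ∈ L, degIn G (L ∪ H) v ≤ l := by
        intro v hv
        rw [degIn_union hLH, (degIn_eq_zero_iff H v).2 (hc v hv)]
        have := degIn_lt_card (G := G) hv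
        omega
      have h2 : ∀ w ∈ H, degIn G (L ∪ H) w + 1 ≤ H.card := by
        intro w hw
        rw [degIn_union hLH, (degIn_eq_zero_iff L w).2 (fun v hv h => hc v hv w hw h.symm)]
        have := degIn_lt_card (G := G) hw
        omega
      have h3 := Finset.sum_le_card_nsmul _ _ _ h1
      have h4 := Finset.sum_le_card_nsmul _ _ _ h2
      rw [Finset.sum_add_distrib, Finset.sum_const, smul_eq_mul, smul_eq_mul] at h4
      unfold degSum
      rw [Finset.sum_union hLH]
      rw [hl, smul_eq_mul] at h3
      nlinarith

/-- If no vertex of `L` is in a triangle, then the number of edges in `L ∪ H` exceeds the number of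
edges in a complete graph on `H` by at most a quarter of `|L ∪ H|²`. -/
lemma two_mul_degSum_union_le {L H : Finset V} (hLH : Disjoint L H)
    (hL : ∀ v ∈ L, ∀ w ∈ L ∪ H, ∀ x ∈ L ∪ H, G.Adj v w → G.Adj v x → ¬ G.Adj w x) :
    2 * degSum G (L ∪ H) + 2 * H.card ≤ 2 * (H.card * H.card) + (L.card + H.card) ^ 2 := by
  induction hl : L.card using Nat.strong_induction_on generalizing L H with
  | _ l ih =>
    -- With `N = |L ∪ H|`, deleting both ends of an edge loses at most `N - 1 = (N² - (N - 2)²) / 4`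
    -- edges, wherever the second end lies.
    by_cases hc : ∃ v ∈ L, ∃ w ∈ L ∪ H, G.Adj v w
    · obtain ⟨v, hv, w, hw, hvw⟩ := hc
      have hvA : v ∈ L ∪ H := Finset.mem_union_left _ hv
      have h2 := degSum_erase_edge hvA hw hvw
      have h3 : degIn G (L ∪ H) v + degIn G (L ∪ H) w ≤ (L ∪ H).card :=
        degIn_add_degIn_le fun x hx hvx hwx => hL v hv w hw x hx hvw hvx hwx
      rw [Finset.card_union_of_disjoint hLH, hl] at h3
      have hv1 := Finset.card_erase_add_one hv
      have hLs : L.erase v ⊆ L := Finset.erase_subset _ _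
      rcases Finset.mem_union.1 hw with hwL | hwH
      · have hwL' : w ∈ L.erase v := Finset.mem_erase.2 ⟨hvw.ne', hwL⟩
        have hLs' : (L.erase v).erase w ⊆ L := (Finset.erase_subset _ _).trans hLs
        have heq : ((L ∪ H).erase v).erase w = (L.erase v).erase w ∪ H := by
          have h5 : v ∉ H := Finset.disjoint_left.1 hLH hv
          have h6 : w ∉ H := Finset.disjoint_left.1 hLH hwL
          rw [Finset.erase_union_distrib, Finset.erase_eq_of_notMem h5,
            Finset.erase_union_distrib, Finset.erase_eq_of_notMem h6]
        have hw1 := Finset.card_erase_add_one hwL'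
        have hsub : (L.erase v).erase w ∪ H ⊆ L ∪ H :=
          Finset.union_subset_union hLs' subset_rfl
        have h1 := ih ((L.erase v).erase w).card (by omega) (L := (L.erase v).erase w) (H := H)
          (hLH.mono_left hLs')
          (fun a ha b hb c hc => hL a (hLs' ha) b (hsub hb) c (hsub hc)) rfl
        rw [heq] at h2
        have hl' : l = ((L.erase v).erase w).card + 2 := by omega
        rw [hl'] at h3 ⊢
        nlinarith
      · have hsub : L.erase v ∪ H.erase w ⊆ L ∪ H :=
          Finset.union_subset_union hLs (Finset.erase_subset _ _)
        have h1 := ih (L.erase v).card (by omega) (L := L.erase v) (H := H.erase w)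
          (hLH.mono hLs (Finset.erase_subset _ _))
          (fun a ha b hb c hc => hL a (hLs ha) b (hsub hb) c (hsub hc)) rfl
        rw [erase_erase_union hLH hv hwH] at h2
        have h4 := Finset.card_erase_add_one hwH
        have hl' : l = (L.erase v).card + 1 := by omega
        rw [hl', ← h4] at h3 ⊢
        nlinarith
    · push Not at hc
      have h1 : ∀ v ∈ L, degIn G (L ∪ H) v ≤ 0 := fun v hv =>
        ((degIn_eq_zero_iff _ v).2 (hc v hv)).le
      have h2 : ∀ w ∈ H, degIn G (L ∪ H) w + 1 ≤ H.card := by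
        intro w hw
        rw [degIn_union hLH, (degIn_eq_zero_iff L w).2
          (fun v hv h => hc v hv w (Finset.mem_union_right _ hw) h.symm)]
        have := degIn_lt_card (G := G) hw
        omega
      have h3 := Finset.sum_le_card_nsmul _ _ _ h1
      have h4 := Finset.sum_le_card_nsmul _ _ _ h2
      rw [Finset.sum_add_distrib, Finset.sum_const, smul_eq_mul, smul_eq_mul] at h4
      unfold degSum
      rw [Finset.sum_union hLH]
      rw [smul_eq_mul] at h3
      nlinarith [Nat.zero_le ((l + H.card) ^ 2)]

variable [Fintype V]

/-- If few vertices are in no triangle, all other vertices satisfy the minimum degree condition for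
a perfect tiling of a suitable set of `3 (k + 1)` vertices. -/
lemma hasDisjointTriangles_of_few {k μ : ℕ} (hn : Fintype.card V = 3 * k + 2 + μ)
    (hμk : μ ≤ k) (hdeg : ∀ v, μ + 1 ≤ degIn G Finset.univ v)
    (htri : ∀ u v w, G.Adj u v → G.Adj u w → G.Adj v w → 2 * Fintype.card V + 2 * k ≤
      degIn G Finset.univ u + degIn G Finset.univ v + degIn G Finset.univ w)
    {L : Finset V} (hL : ∀ v, v ∈ L ↔ ∀ w x, G.Adj v w → G.Adj v x → ¬ G.Adj w x)
    (hl : L.card < μ) : HasDisjointTriangles G (k + 1) := by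
  set d := degIn G Finset.univ with hd
  set n := Fintype.card V with hndef
  -- If `v` lies in `L` or has a neighbour there, it is on an edge in no triangle; the other end has
  -- degree above `μ > |L|`, and the two degrees add up to at most `n`. Otherwise `v` misses itself
  -- and all of `L`.
  have hmax : ∀ v, d v + L.card + 1 ≤ n := by
    intro v
    by_cases hv : ∃ u ∈ L, G.Adj u v
    · obtain ⟨u, hu, huv⟩ := hv
      have h1 : d u + d v ≤ Finset.univ.card := degIn_add_degIn_le fun w _ huw hvw =>
        (hL u).1 hu v w huv huw hvw
      rw [Finset.card_univ] at h1
      have := hdeg u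
      omega
    · push Not at hv
      by_cases hvL : v ∈ L
      · have h4 := hdeg v
        obtain ⟨w, hw⟩ : ∃ w, G.Adj v w := by
          by_contra hcon
          push Not at hcon
          have : d v = 0 := (degIn_eq_zero_iff (G := G) Finset.univ v).2 fun w _ => hcon w
          omega
        have h5 : d v + d w ≤ Finset.univ.card := degIn_add_degIn_le fun x _ hvx hwx =>
          (hL v).1 hvL w x hw hvx hwx
        rw [Finset.card_univ] at h5
        have := hdeg w
        omega
      · have h1 : _ = d v := degIn_sdiff (G := G) (Finset.subset_univ (insert v L)) v
        have h0 : degIn G (insert v L) v = 0 := by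
          rw [degIn_insert_self]
          exact (degIn_eq_zero_iff L v).2 fun w hw h => hv w hw h.symm
        have h2 := degIn_le_card (G := G) (Finset.univ \ insert v L) v
        have h3 := Finset.card_sdiff_add_card_eq_card (Finset.subset_univ (insert v L))
        rw [Finset.card_univ, Finset.card_insert_of_notMem hvL] at h3
        omega
  set H := Finset.univ \ L with hH
  have hHcard : H.card + L.card = n := by
    rw [hH, Finset.card_sdiff_add_card_eq_card (Finset.subset_univ L), Finset.card_univ]
  have hHdeg : ∀ v ∈ H, 2 * k + 2 + 2 * L.card ≤ d v := by
    intro v hv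
    have h1 : v ∉ L := (Finset.mem_sdiff.1 hv).2
    rw [hL] at h1
    push Not at h1
    obtain ⟨w, x, hvw, hvx, hwx⟩ := h1
    have h2 := htri v w x hvw hvx hwx
    have h3 := hmax w
    have h4 := hmax x
    omega
  have hdH : ∀ v, d v ≤ degIn G H v + L.card := by
    intro v
    have h1 : degIn G L v + degIn G H v = d v := degIn_sdiff (Finset.subset_univ L) v
    have h2 := degIn_le_card (G := G) L v
    omega
  -- Half of `n + 2k + 1 + |L|` is the threshold for which two adjacent vertices of low degree, with
  -- a common neighbour of degree at most `n - |L| - 1`, violate the triangle condition. Hence `S`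
  -- is independent.
  set S := H.filter fun v => 2 * d v < n + 2 * k + 1 + L.card with hS
  set B := H \ S with hB
  have hSH : S ⊆ H := Finset.filter_subset _ _
  have hSind : ∀ u ∈ S, ∀ v ∈ S, ¬ G.Adj u v := by
    intro u hu v hv huv
    have hu1 := hHdeg u (hSH hu)
    have hv1 := hHdeg v (hSH hv)
    have hu2 := (Finset.mem_filter.1 hu).2
    have hv2 := (Finset.mem_filter.1 hv).2
    obtain ⟨w, -, huw, hvw⟩ := exists_common_of_card_lt (G := G) (A := Finset.univ) (u := u)
      (v := v) (by rw [Finset.card_univ, ← hndef, ← hd]; omega)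
    have h1 := htri u v w huv huw hvw
    have h2 := hmax w
    omega
  have hBcard : B.card + S.card = H.card := Finset.card_sdiff_add_card_eq_card hSH
  have hSB : ∀ v ∈ S, 2 * k + 2 ≤ degIn G B v := by
    intro v hv
    have h1 := degIn_sdiff (G := G) hSH v
    rw [(degIn_eq_zero_iff S v).2 (hSind v hv), ← hB] at h1
    have h2 := hdH v
    have h3 := hHdeg v (hSH hv)
    omega
  -- `|L| < μ` leaves at least `3 (k + 1)` vertices in `H`. Vertices of `S` are used only once all
  -- of `B` is, because their neighbours in `H` all lie in `B`.
  obtain ⟨W, hWH, hWcard, hWB⟩ : ∃ W ⊆ H, W.card = 3 * (k + 1) ∧ (W ⊆ B ∨ B ⊆ W) := by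
    rcases le_total (3 * (k + 1)) B.card with h | h
    · obtain ⟨W, hW, hc⟩ := Finset.exists_subset_card_eq h
      exact ⟨W, hW.trans Finset.sdiff_subset, hc, Or.inl hW⟩
    · obtain ⟨W, hBW, hWH, hc⟩ := Finset.exists_subsuperset_card_eq
        (Finset.sdiff_subset : B ⊆ H) h (by omega)
      exact ⟨W, hWH, hc, Or.inr hBW⟩
  refine hasDisjointTriangles_of_degIn hWcard fun v hv => ?_
  by_cases hvS : v ∈ S
  · rcases hWB with h | h
    · exact absurd hvS (Finset.mem_sdiff.1 (h hv)).2
    · have h1 := hSB v hvS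
      have h2 := degIn_mono (G := G) h v
      omega
  · have hvH := hWH hv
    -- At most `|V| - |W| = μ - 1` neighbours are lost, and `μ ≤ k` leaves at least `2k + 2`.
    have h1 : ¬ 2 * d v < n + 2 * k + 1 + L.card := fun h => hvS (Finset.mem_filter.2 ⟨hvH, h⟩)
    have h2 := degIn_sdiff (G := G) hWH v
    have h3 := degIn_le_card (G := G) (H \ W) v
    have h4 := Finset.card_sdiff_add_card_eq_card hWH
    have h5 := hdH v
    omega

/-- The dense case: a graph with the given degree conditions has `k + 1` disjoint triangles, or it
has at most as many edges as one of the extremal graphs. -/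
theorem hasDisjointTriangles_or_degSum_le {k μ : ℕ} (hn : Fintype.card V = 3 * k + 2 + μ)
    (hμk : μ ≤ k) (hdeg : ∀ v, μ + 1 ≤ degIn G Finset.univ v)
    (htri : ∀ u v w, G.Adj u v → G.Adj u w → G.Adj v w → 2 * Fintype.card V + 2 * k ≤
      degIn G Finset.univ u + degIn G Finset.univ v + degIn G Finset.univ w) :
    HasDisjointTriangles G (k + 1) ∨
      degSum G Finset.univ ≤ (3 * k + 2) * (3 * k + 1) + μ * (μ + 1) ∨
      degSum G Finset.univ ≤ (2 * k + 1) * (2 * k) + 2 * ((2 * k + 1) * (k + 1 + μ)) := by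
  set L : Finset V := Finset.univ.filter fun v => ∀ w x, G.Adj v w → G.Adj v x → ¬ G.Adj w x
    with hLdef
  have hL : ∀ v, v ∈ L ↔ ∀ w x, G.Adj v w → G.Adj v x → ¬ G.Adj w x := fun v => by
    rw [hLdef, Finset.mem_filter]
    simp
  rcases Nat.lt_or_ge L.card μ with hl | hl
  · exact Or.inl (hasDisjointTriangles_of_few hn hμk hdeg htri hL hl)
  right
  set H := Finset.univ \ L with hH
  have hHcard : H.card + L.card = 3 * k + 2 + μ := by
    rw [hH, Finset.card_sdiff_add_card_eq_card (Finset.subset_univ L), Finset.card_univ, hn]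
  have hd : Disjoint L H := Finset.disjoint_sdiff
  have hLH : L ∪ H = Finset.univ := Finset.union_sdiff_of_subset (Finset.subset_univ L)
  have hfree : ∀ v ∈ L, ∀ w ∈ L ∪ H, ∀ x ∈ L ∪ H, G.Adj v w → G.Adj v x → ¬ G.Adj w x :=
    fun v hv w _ x _ => (hL v).1 hv w x
  -- The bound of `degSum_union_le` is convex in `|L|` for fixed `n`, and takes the same value at
  -- the two ends `|L| = μ` and `|L| = 3k + 1`.
  rcases Nat.lt_or_ge L.card (3 * k + 2) with hl2 | hl2
  · left
    have h1 := degSum_union_le hd hfree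
    rw [hLH] at h1
    obtain ⟨i, hi⟩ := Nat.exists_eq_add_of_le hl
    obtain ⟨j, hj⟩ := Nat.exists_eq_add_of_lt hl2
    have hHj : H.card = j + 1 + μ := by omega
    have hk' : 3 * k + 1 = μ + i + j := by omega
    rw [hHj, hi] at h1
    rw [show 3 * k + 2 = μ + i + j + 1 by omega, hk']
    nlinarith [Nat.zero_le (i * j)]
  -- Now `|H| ≤ μ ≤ k`, and a quarter of `n²` plus a clique on `μ` vertices stays below the count of
  -- `E₃`.
  · right
    have h1 := two_mul_degSum_union_le hd hfree
    rw [hLH] at h1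
    have hHμ : H.card ≤ μ := by omega
    have h2 : H.card * H.card + μ ≤ μ * μ + H.card := by
      obtain ⟨j, rfl⟩ := Nat.exists_eq_add_of_le hHμ
      nlinarith [Nat.zero_le (H.card * j), Nat.le_mul_self j]
    rw [add_comm L.card, hHcard] at h1
    obtain ⟨j, rfl⟩ := Nat.exists_eq_add_of_le hμk
    nlinarith [Nat.zero_le (μ * j), Nat.zero_le (μ * μ), Nat.zero_le (j * j)]

end Dense

end DensityCH

/-! ### Arithmetic of the extremal edge numbers. -/

namespace DensityCH

/-- The number of edges of `E₁(n,k)`. -/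
def num₁ (n k : ℕ) : ℕ := k.choose 2 + k * (n - k) + (n - k) / 2 * ((n - k + 1) / 2)

/-- The number of edges of `E₂(n,k)`. -/
def num₂ (n k : ℕ) : ℕ := (2 * k + 1).choose 2 + n / 2 * ((n + 1) / 2)

/-- The number of edges of `E₃(n,k)`. -/
def num₃ (n k : ℕ) : ℕ := (2 * k + 1).choose 2 + (2 * k + 1) * (n - (2 * k + 1))

/-- The number of edges of `E₄(n,k)` if this is not the complete graph. -/
def num₄ (n k : ℕ) : ℕ := (3 * k + 2).choose 2 + (n - (3 * k + 1)).choose 2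

/-- The maximum number of edges of the extremal graphs. -/
def maxNum (n k : ℕ) : ℕ :=
  if n ≤ 3 * k + 2 then n.choose 2
  else max (max (num₁ n k) (num₃ n k))
    (max (if 4 * k + 2 ≤ n then num₂ n k else 0) (if n ≤ 6 * k + 4 then num₄ n k else 0))

/-- The remainder modulo `2`. -/
def parity (n : ℕ) : ℕ := n % 2

section Numerics

lemma two_mul_choose_two (n : ℕ) : (2 : ℤ) * (n.choose 2 : ℕ) = n * (n - 1) := by
  induction n with
  | zero => simp
  | succ n ih =>
    rw [Nat.choose_succ_succ' n 1, Nat.choose_one_right]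
    push_cast
    linarith

lemma four_mul_quarter (n : ℕ) :
    (4 : ℤ) * ((n / 2 * ((n + 1) / 2) : ℕ) : ℤ) = n ^ 2 - parity n := by
  unfold parity
  rcases Nat.even_or_odd' n with ⟨a, rfl | rfl⟩
  · rw [show 2 * a / 2 = a by omega, show (2 * a + 1) / 2 = a by omega,
      show 2 * a % 2 = 0 by omega]
    push_cast; ring
  · rw [show (2 * a + 1) / 2 = a by omega, show (2 * a + 1 + 1) / 2 = a + 1 by omega,
      show (2 * a + 1) % 2 = 1 by omega]
    push_cast; ring

lemma four_mul_num₁ {n k : ℕ} (h : k ≤ n) : (4 : ℤ) * num₁ n k =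
    2 * (k * (k - 1)) + 4 * (k * (n - k)) + (n - k) ^ 2 - parity (n - k) := by
  have h1 := four_mul_quarter (n - k)
  have h2 := two_mul_choose_two k
  unfold num₁
  push_cast [h] at h1 h2 ⊢
  linarith

lemma four_mul_num₂ (n k : ℕ) : (4 : ℤ) * num₂ n k =
    2 * ((2 * k + 1) * (2 * k)) + n ^ 2 - parity n := by
  have h1 := four_mul_quarter n
  have h2 := two_mul_choose_two (2 * k + 1)
  unfold num₂
  push_cast at h1 h2 ⊢
  linarith

lemma four_mul_num₃ {n k : ℕ} (h : 2 * k + 1 ≤ n) : (4 : ℤ) * num₃ n k =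
    2 * ((2 * k + 1) * (2 * k)) + 4 * ((2 * k + 1) * (n - 2 * k - 1)) := by
  have h2 := two_mul_choose_two (2 * k + 1)
  unfold num₃
  push_cast [h] at h2 ⊢
  linarith

lemma four_mul_num₄ {n k : ℕ} (h : 3 * k + 1 ≤ n) : (4 : ℤ) * num₄ n k =
    2 * ((3 * k + 2) * (3 * k + 1)) + 2 * ((n - 3 * k - 1) * (n - 3 * k - 2)) := by
  have h2 := two_mul_choose_two (3 * k + 2)
  have h3 := two_mul_choose_two (n - (3 * k + 1))
  unfold num₄
  push_cast [h] at h2 h3 ⊢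
  linarith

lemma num₁_le_maxNum {n k : ℕ} (h : 3 * k + 3 ≤ n) : num₁ n k ≤ maxNum n k := by
  rw [maxNum, if_neg (by omega)]
  exact (le_max_left _ _).trans (le_max_left _ _)

lemma num₃_le_maxNum {n k : ℕ} (h : 3 * k + 3 ≤ n) : num₃ n k ≤ maxNum n k := by
  rw [maxNum, if_neg (by omega)]
  exact (le_max_right _ _).trans (le_max_left _ _)

lemma num₂_le_maxNum {n k : ℕ} (h : 3 * k + 3 ≤ n) (h' : 4 * k + 2 ≤ n) :
    num₂ n k ≤ maxNum n k := by
  rw [maxNum, if_neg (by omega), if_pos h']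
  exact (le_max_left _ _).trans (le_max_right _ _)

lemma num₄_le_maxNum {n k : ℕ} (h : 3 * k + 3 ≤ n) (h' : n ≤ 6 * k + 4) :
    num₄ n k ≤ maxNum n k := by
  rw [maxNum, if_neg (by omega), if_pos h']
  exact (le_max_right _ _).trans (le_max_right _ _)

lemma maxNum_le {n k m : ℕ} (h : 3 * k + 3 ≤ n) (h₁ : num₁ n k ≤ m) (h₃ : num₃ n k ≤ m)
    (h₂ : 4 * k + 2 ≤ n → num₂ n k ≤ m) (h₄ : n ≤ 6 * k + 4 → num₄ n k ≤ m) :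
    maxNum n k ≤ m := by
  rw [maxNum, if_neg (by omega)]
  refine max_le (max_le h₁ h₃) (max_le ?_ ?_)
  · split_ifs with h'
    exacts [h₂ h', Nat.zero_le _]
  · split_ifs with h'
    exacts [h₄ h', Nat.zero_le _]

/-- Up to the parity term, `4 num₂ - 4 num₃` is the square of `n - 4k - 2`. -/
lemma num₃_le_num₂ {n k : ℕ} (h : 4 * k + 2 ≤ n) : num₃ n k ≤ num₂ n k := by
  have h3 := four_mul_num₃ (n := n) (k := k) (by omega)
  have h2 := four_mul_num₂ n k
  have hp : parity n ≤ 1 := by unfold parity; omega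
  zify at hp ⊢
  -- Integrality leaves a slack below 4, which absorbs the parity term; the same device recurs
  -- below.
  suffices (4 : ℤ) * num₃ n k < 4 * num₂ n k + 4 by omega
  nlinarith [sq_nonneg ((n : ℤ) - 4 * k - 2)]

lemma num₂_le_num₃ {n k : ℕ} (h : 4 * k + 2 ≤ n) (h' : n ≤ 4 * k + 3) :
    num₂ n k ≤ num₃ n k := by
  have h3 := four_mul_num₃ (n := n) (k := k) (by omega)
  have h2 := four_mul_num₂ n k
  zify at h h' ⊢
  suffices (4 : ℤ) * num₂ n k < 4 * num₃ n k + 4 by omega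
  nlinarith [mul_nonneg (sub_nonneg.2 h) (sub_nonneg.2 h')]

lemma num₄_le_num₂ {n k : ℕ} (h : 4 * k + 2 ≤ n) (h' : n ≤ 6 * k + 4) :
    num₄ n k ≤ num₂ n k := by
  have h4 := four_mul_num₄ (n := n) (k := k) (by omega)
  have h2 := four_mul_num₂ n k
  have hp : parity n ≤ 1 := by unfold parity; omega
  have hk : (0 : ℤ) ≤ k := by positivity
  zify at hp h h' ⊢
  suffices (4 : ℤ) * num₄ n k < 4 * num₂ n k + 4 by omega
  nlinarith [mul_nonneg (sub_nonneg.2 h) (sub_nonneg.2 h'), mul_nonneg hk hk,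
    mul_nonneg hk (sub_nonneg.2 h)]

lemma num₂_le_num₁ {n k : ℕ} (h : 6 * k + 6 ≤ n) : num₂ n k ≤ num₁ n k := by
  have h1 := four_mul_num₁ (n := n) (k := k) (by omega)
  have h2 := four_mul_num₂ n k
  have hp : parity (n - k) ≤ 1 := by unfold parity; omega
  have hk : (0 : ℤ) ≤ k := by positivity
  zify at hp h ⊢
  suffices (4 : ℤ) * num₂ n k < 4 * num₁ n k + 4 by omega
  nlinarith [mul_nonneg hk (sub_nonneg.2 h)]

lemma num₁_le_num₃ {n k : ℕ} (h : 3 * k + 3 ≤ n) (h' : n ≤ 4 * k + 3) :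
    num₁ n k ≤ num₃ n k := by
  have h1 := four_mul_num₁ (n := n) (k := k) (by omega)
  have h3 := four_mul_num₃ (n := n) (k := k) (by omega)
  have hk : (0 : ℤ) ≤ k := by positivity
  zify at h h' ⊢
  suffices (4 : ℤ) * num₁ n k < 4 * num₃ n k + 4 by omega
  nlinarith [mul_nonneg (sub_nonneg.2 h) (sub_nonneg.2 h'), mul_nonneg hk (sub_nonneg.2 h),
    mul_nonneg hk (sub_nonneg.2 h')]

lemma num₄_le_num₃ {n k : ℕ} (h : 7 * k + 6 ≤ 2 * n) (h' : n ≤ 4 * k + 3) :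
    num₄ n k ≤ num₃ n k := by
  have h4 := four_mul_num₄ (n := n) (k := k) (by omega)
  have h3 := four_mul_num₃ (n := n) (k := k) (by omega)
  have hk : (0 : ℤ) ≤ k := by positivity
  zify at h h' ⊢
  suffices (4 : ℤ) * num₄ n k < 4 * num₃ n k + 4 by omega
  nlinarith [mul_nonneg (sub_nonneg.2 h) (sub_nonneg.2 h'), mul_nonneg hk (sub_nonneg.2 h),
    mul_nonneg hk (sub_nonneg.2 h')]

lemma maxNum_le_max₁₂ {n k : ℕ} (h : 4 * k + 2 ≤ n) : maxNum n k ≤ max (num₁ n k) (num₂ n k) := by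
  rcases Nat.lt_or_ge n (3 * k + 3) with h3 | h3
  -- The complete graph meets this range only at `n = 2`, `k = 0`.
  · obtain rfl : k = 0 := by omega
    obtain rfl : n = 2 := by omega
    decide
  · exact maxNum_le h3 (le_max_left _ _) ((num₃_le_num₂ h).trans (le_max_right _ _))
      (fun _ => le_max_right _ _) (fun h' => (num₄_le_num₂ h h').trans (le_max_right _ _))

lemma maxNum_add_half_le {n k : ℕ} (h : 4 * k + 2 ≤ n) :
    maxNum n k + (n + 1) / 2 ≤ maxNum (n + 1) k := by
  have h1 := maxNum_le_max₁₂ h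
  have h2 := num₁_le_maxNum (n := n + 1) (k := k) (by omega)
  have h3 := num₂_le_maxNum (n := n + 1) (k := k) (by omega) (by omega)
  have h4 : num₁ n k + (n + 1) / 2 ≤ num₁ (n + 1) k := by
    have e1 := four_mul_num₁ (n := n) (k := k) (by omega)
    have e2 := four_mul_num₁ (n := n + 1) (k := k) (by omega)
    have e3 : 2 * ((n + 1) / 2) ≤ n + 1 := by omega
    generalize (n + 1) / 2 = c at e3 ⊢
    have e4 : parity (n + 1 - k) ≤ parity (n - k) + 1 := by unfold parity; omega
    have hk : (0 : ℤ) ≤ k := by positivity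
    push_cast at e2
    zify at e3 e4 ⊢
    suffices (4 : ℤ) * (num₁ n k + c) < 4 * num₁ (n + 1) k + 4 by omega
    nlinarith
  have h5 : num₂ n k + (n + 1) / 2 ≤ num₂ (n + 1) k := by
    have e1 := four_mul_num₂ n k
    have e2 := four_mul_num₂ (n + 1) k
    have e3 : 2 * ((n + 1) / 2) ≤ n + 1 := by omega
    generalize (n + 1) / 2 = c at e3 ⊢
    have e4 : parity (n + 1) ≤ parity n + 1 := by unfold parity; omega
    push_cast at e2
    zify at e3 e4 ⊢
    suffices (4 : ℤ) * (num₂ n k + c) < 4 * num₂ (n + 1) k + 4 by omega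
    nlinarith
  rcases le_total (num₁ n k) (num₂ n k) with hle | hle
  · rw [max_eq_right hle] at h1; omega
  · rw [max_eq_left hle] at h1; omega

/-- For `num₁` the increment is exactly `2 (n + 3) + (k + 1) - 4`. For `num₂` it is large enough
only while `n ≤ 6k + 5`; beyond that `num₁` is the larger one. -/
lemma maxNum_triangle_sparse {n k : ℕ} (h : 4 * k + 4 ≤ n) :
    maxNum n k + (2 * (n + 3) + (k + 1)) ≤ maxNum (n + 3) (k + 1) + 4 := by
  have h1 := maxNum_le_max₁₂ (n := n) (k := k) (by omega)
  have h2 := num₁_le_maxNum (n := n + 3) (k := k + 1) (by omega)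
  have h3 := num₂_le_maxNum (n := n + 3) (k := k + 1) (by omega) (by omega)
  have h4 : num₁ n k + (2 * (n + 3) + (k + 1)) ≤ num₁ (n + 3) (k + 1) + 4 := by
    have e1 := four_mul_num₁ (n := n) (k := k) (by omega)
    have e2 := four_mul_num₁ (n := n + 3) (k := k + 1) (by omega)
    have e4 : parity (n + 3 - (k + 1)) = parity (n - k) := by unfold parity; omega
    rw [e4] at e2
    push_cast at e2
    zify
    nlinarith
  have h5 : n ≤ 6 * k + 5 → num₂ n k + (2 * (n + 3) + (k + 1)) ≤ num₂ (n + 3) (k + 1) + 4 := by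
    intro h'
    have e1 := four_mul_num₂ n k
    have e2 := four_mul_num₂ (n + 3) (k + 1)
    have e4 : parity (n + 3) ≤ parity n + 1 := by unfold parity; omega
    push_cast at e2
    zify at e4 h' ⊢
    suffices (4 : ℤ) * (num₂ n k + (2 * (n + 3) + (k + 1))) < 4 * (num₂ (n + 3) (k + 1) + 4) + 4 by
      omega
    nlinarith
  rcases Nat.lt_or_ge n (6 * k + 6) with hn | hn
  · have h5 := h5 (by omega)
    rcases le_total (num₁ n k) (num₂ n k) with hle | hle
    · rw [max_eq_right hle] at h1; omega
    · rw [max_eq_left hle] at h1; omega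
  · rw [max_eq_left (num₂_le_num₁ hn)] at h1
    omega

/-- A new vertex adds exactly `n - (3k + 1)` to `num₄`, and at least as much to `num₁` and `num₃`
once `n > 3k + 2`. At `n = 3k + 2` the complete graph agrees with the formula `num₄`. -/
lemma maxNum_add_le_dense {n k : ℕ} (h : 3 * k + 2 ≤ n) (h' : n ≤ 4 * k + 1) :
    maxNum n k + (n - (3 * k + 1)) ≤ maxNum (n + 1) k := by
  have h1 := num₁_le_maxNum (n := n + 1) (k := k) (by omega)
  have h3 := num₃_le_maxNum (n := n + 1) (k := k) (by omega)
  have h4 := num₄_le_maxNum (n := n + 1) (k := k) (by omega) (by omega)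
  obtain ⟨m, rfl⟩ := Nat.exists_eq_add_of_le h
  rw [show 3 * k + 2 + m - (3 * k + 1) = m + 1 by omega]
  have e4 : num₄ (3 * k + 2 + m) k + (m + 1) = num₄ (3 * k + 2 + m + 1) k := by
    have e1 := four_mul_num₄ (n := 3 * k + 2 + m) (k := k) (by omega)
    have e2 := four_mul_num₄ (n := 3 * k + 2 + m + 1) (k := k) (by omega)
    push_cast at e1 e2
    zify
    nlinarith
  rcases Nat.eq_zero_or_pos m with rfl | hm
  · have : maxNum (3 * k + 2 + 0) k = num₄ (3 * k + 2 + 0) k := by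
      rw [maxNum, if_pos (by omega), num₄, show 3 * k + 2 + 0 - (3 * k + 1) = 1 by omega]
      simp
    omega
  · have e1 : num₁ (3 * k + 2 + m) k + (m + 1) ≤ num₁ (3 * k + 2 + m + 1) k := by
      have e1 := four_mul_num₁ (n := 3 * k + 2 + m) (k := k) (by omega)
      have e2 := four_mul_num₁ (n := 3 * k + 2 + m + 1) (k := k) (by omega)
      have e3 : parity (3 * k + 2 + m + 1 - k) ≤ parity (3 * k + 2 + m - k) + 1 := by unfold parity; omega
      push_cast at e1 e2
      zify at e3 h' ⊢
      nlinarith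
    have e3 : num₃ (3 * k + 2 + m) k + (m + 1) ≤ num₃ (3 * k + 2 + m + 1) k := by
      have e1 := four_mul_num₃ (n := 3 * k + 2 + m) (k := k) (by omega)
      have e2 := four_mul_num₃ (n := 3 * k + 2 + m + 1) (k := k) (by omega)
      push_cast at e1 e2
      zify at h' ⊢
      nlinarith
    have : maxNum (3 * k + 2 + m) k ≤ maxNum (3 * k + 2 + m + 1) k - (m + 1) :=
      maxNum_le (by omega) (by omega) (by omega) (by omega) (by omega)
    omega

/-- For `num₃` this is an equality. The increment `9 (k + 1)` of `num₄` is enough when `2n < 7k +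
6`; from there on `num₃` dominates `num₄`. -/
lemma maxNum_triangle_dense {n k : ℕ} (h : 3 * k + 3 ≤ n) (h' : n ≤ 4 * k + 3) :
    maxNum n k + (2 * (n + 3) + 2 * (k + 1)) ≤ maxNum (n + 3) (k + 1) + 4 := by
  have h3 := num₃_le_maxNum (n := n + 3) (k := k + 1) (by omega)
  have h4 := num₄_le_maxNum (n := n + 3) (k := k + 1) (by omega) (by omega)
  have e3 : num₃ n k + (2 * (n + 3) + 2 * (k + 1)) = num₃ (n + 3) (k + 1) + 4 := by
    have e1 := four_mul_num₃ (n := n) (k := k) (by omega)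
    have e2 := four_mul_num₃ (n := n + 3) (k := k + 1) (by omega)
    push_cast at e1 e2
    zify
    nlinarith
  have e4 : num₄ n k + 9 * (k + 1) = num₄ (n + 3) (k + 1) := by
    have e1 := four_mul_num₄ (n := n) (k := k) (by omega)
    have e2 := four_mul_num₄ (n := n + 3) (k := k + 1) (by omega)
    push_cast at e1 e2
    zify
    nlinarith
  have e1 := num₁_le_num₃ h h'
  have e2 := fun h2 : 4 * k + 2 ≤ n => num₂_le_num₃ h2 h'
  have e5 := fun h5 : 7 * k + 6 ≤ 2 * n => num₄_le_num₃ h5 h'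
  have : maxNum n k ≤ maxNum (n + 3) (k + 1) + 4 - (2 * (n + 3) + 2 * (k + 1)) :=
    maxNum_le h (by omega) (by omega) (by omega) (by omega)
  omega

lemma maxNum_le_succ {n k : ℕ} (h : 3 * k + 6 ≤ n) : maxNum n k ≤ maxNum n (k + 1) := by
  have h1 := num₁_le_maxNum (n := n) (k := k + 1) (by omega)
  have h3 := num₃_le_maxNum (n := n) (k := k + 1) (by omega)
  have h2 := num₂_le_maxNum (n := n) (k := k + 1) (by omega)
  have h4 := num₄_le_maxNum (n := n) (k := k + 1) (by omega)
  have hk : (0 : ℤ) ≤ k := by positivity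
  have f3 : num₃ n k + 4 ≤ num₃ n (k + 1) := by
    have e1 := four_mul_num₃ (n := n) (k := k) (by omega)
    have e2 := four_mul_num₃ (n := n) (k := k + 1) (by omega)
    push_cast at e1 e2
    zify at h ⊢
    nlinarith
  refine maxNum_le (by omega) (le_trans ?_ h1) (by omega) (fun h2' => ?_) (fun h4' => ?_)
  · have e1 := four_mul_num₁ (n := n) (k := k) (by omega)
    have e2 := four_mul_num₁ (n := n) (k := k + 1) (by omega)
    have e3 : parity (n - (k + 1)) ≤ parity (n - k) + 1 := by unfold parity; omega
    push_cast at e1 e2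
    zify at e3 h ⊢
    nlinarith
  -- Below `4k + 6` the second construction does not exist for `k + 1`; there `num₂` exceeds `num₃`
  -- by so little that the growth of `num₃` makes up for it.
  · rcases Nat.lt_or_ge n (4 * k + 6) with hn | hn
    · have e1 := four_mul_num₃ (n := n) (k := k) (by omega)
      have e2 := four_mul_num₂ n k
      have : num₂ n k ≤ num₃ n k + 4 := by
        zify at h2' hn ⊢
        nlinarith [mul_nonneg (sub_nonneg.2 h2') (sub_nonneg.2 hn.le)]
      omega
    · have e1 := four_mul_num₂ n k
      have e2 := four_mul_num₂ n (k + 1)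
      have h2 := h2 (by omega)
      push_cast at e2
      zify at h2 ⊢
      nlinarith
  · refine le_trans ?_ (h4 (by omega))
    have e1 := four_mul_num₄ (n := n) (k := k) (by omega)
    have e2 := four_mul_num₄ (n := n) (k := k + 1) (by omega)
    push_cast at e1 e2
    zify at h h4' ⊢
    nlinarith

end Numerics

end DensityCH

/-! ### The induction on `n` and `k`. -/

namespace DensityCH

section UpperBound

open scoped Classical

universe u

lemma numEdges_le_choose {V : Type*} [Fintype V] (G : SimpleGraph V) :
    numEdges G ≤ (Fintype.card V).choose 2 := by
  have h1 := degSum_le (G := G) Finset.univ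
  rw [degSum_univ, Finset.card_univ] at h1
  rw [Nat.choose_two_right]
  omega

lemma numEdges_eq_add_degIn {V : Type*} [Fintype V] (G : SimpleGraph V) (v : V) :
    numEdges G = numEdges (G.induce ((Finset.univ.erase v : Finset V) : Set V))
      + degIn G Finset.univ v := by
  have h1 := degSum_erase (G := G) (Finset.mem_univ v)
  rw [degSum_univ, ← two_mul_numEdges_induce] at h1
  omega

/-- The three edges of the triangle are counted twice in its degree sum. -/
lemma numEdges_add_three {V : Type*} [Fintype V] (G : SimpleGraph V) {u v w : V}
    (huv : G.Adj u v) (huw : G.Adj u w) (hvw : G.Adj v w) :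
    numEdges G + 3 =
      numEdges (G.induce ((((Finset.univ.erase u).erase v).erase w : Finset V) : Set V))
      + (degIn G Finset.univ u + degIn G Finset.univ v + degIn G Finset.univ w) := by
  have h1 := degSum_erase_edge (Finset.mem_univ u) (Finset.mem_univ v) huv
  have hv : v ∈ Finset.univ.erase u := by simp [huv.ne']
  have hw : w ∈ (Finset.univ.erase u).erase v := by simp [huw.ne', hvw.ne']
  have h2 := degSum_erase (G := G) hw
  have h3 := degIn_insert (G := G) (Finset.notMem_erase u Finset.univ) w
  have h4 := degIn_insert (G := G) (Finset.notMem_erase v (Finset.univ.erase u)) w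
  rw [Finset.insert_erase (Finset.mem_univ u), if_pos huw.symm] at h3
  rw [Finset.insert_erase hv, if_pos hvw.symm] at h4
  rw [degSum_univ] at h1
  rw [← two_mul_numEdges_induce ((((Finset.univ.erase u).erase v).erase w))] at h2
  omega

/-- A graph on `n` vertices without `k + 1` disjoint triangles has at most `maxNum n k` edges. -/
theorem numEdges_le_maxNum (n : ℕ) : ∀ (k : ℕ), 3 * k ≤ n →
    ∀ (V : Type u) [Fintype V] (G : SimpleGraph V), Fintype.card V = n →
      ¬ HasDisjointTriangles G (k + 1) → numEdges G ≤ maxNum n k := by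
  induction n using Nat.strong_induction_on with
  | _ n ih =>
  intro k
  induction k with
  | zero =>
    intro _ V _ G hV hno
    rcases Nat.lt_or_ge n 3 with hn | hn
    · rw [maxNum, if_pos (by omega), ← hV]
      exact numEdges_le_choose G
    by_contra hlt
    have hdeg : ∀ v, Fintype.card V / 2 + 1 ≤ degIn G Finset.univ v := by
      intro v
      have h1 := numEdges_eq_add_degIn G v
      have hc := Finset.card_erase_of_mem (Finset.mem_univ v)
      rw [Finset.card_univ, hV] at hc
      have h2 := ih (n - 1) (by omega) 0 (by omega) _
        (G.induce ((Finset.univ.erase v : Finset V) : Set V)) (by simpa using hc)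
        (fun h => hno (hasDisjointTriangles_of_induce h))
      have h3 := maxNum_add_half_le (n := n - 1) (k := 0) (by omega)
      rw [Nat.sub_add_cancel (by omega)] at h3
      omega
    -- For `k = 0` there are no triangles at all, so the condition on them is vacuous.
    refine hno (hasDisjointTriangles_succ_of_sparse (by omega) hdeg (fun u v w huv huw hvw => ?_)
      (hasDisjointTriangles_iff.2 ⟨∅, IsTiling.empty, rfl⟩))
    exact absurd (hasDisjointTriangles_iff.2
      ⟨_, IsTiling.singleton (isNClique_triple huv huw hvw), rfl⟩) hno
  | succ k ihk =>
    intro hkn V _ G hV hno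
    rcases Nat.lt_or_ge n (3 * k + 6) with hn | hn
    · rw [maxNum, if_pos (by omega), ← hV]
      exact numEdges_le_choose G
    by_contra hlt
    have hk : HasDisjointTriangles G (k + 1) := by
      by_contra hk
      have h1 := ihk (by omega) V G hV hk
      have h2 := maxNum_le_succ hn
      omega
    have hdeg : ∀ v, maxNum n (k + 1) + 1 ≤ maxNum (n - 1) (k + 1) + degIn G Finset.univ v := by
      intro v
      have h1 := numEdges_eq_add_degIn G v
      have hc := Finset.card_erase_of_mem (Finset.mem_univ v)
      rw [Finset.card_univ, hV] at hc
      have h2 := ih (n - 1) (by omega) (k + 1) (by omega) _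
        (G.induce ((Finset.univ.erase v : Finset V) : Set V)) (by simpa using hc)
        (fun h => hno (hasDisjointTriangles_of_induce h))
      omega
    have htri : ∀ u v w, G.Adj u v → G.Adj u w → G.Adj v w → maxNum n (k + 1) + 4 ≤
        maxNum (n - 3) k + (degIn G Finset.univ u + degIn G Finset.univ v
          + degIn G Finset.univ w) := by
      intro u v w huv huw hvw
      have h1 := numEdges_add_three G huv huw hvw
      have hv : v ∈ Finset.univ.erase u := by simp [huv.ne']
      have hw : w ∈ (Finset.univ.erase u).erase v := by simp [huw.ne', hvw.ne']
      have hc : (((Finset.univ.erase u).erase v).erase w).card = n - 3 := by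
        rw [Finset.card_erase_of_mem hw, Finset.card_erase_of_mem hv,
          Finset.card_erase_of_mem (Finset.mem_univ u), Finset.card_univ, hV]
        omega
      have h2 := ih (n - 3) (by omega) k (by omega) _
        (G.induce ((((Finset.univ.erase u).erase v).erase w : Finset V) : Set V))
        (by rw [← hc]; exact (Fintype.card_congr (Equiv.refl _)).trans (Fintype.card_coe _))
        (fun h => hno (hasDisjointTriangles_succ_of_induce (isNClique_triple huv huw hvw)
          (by
            rw [Finset.disjoint_right]
            intro x hx
            simp only [Finset.mem_insert, Finset.mem_singleton] at hx
            rcases hx with rfl | rfl | rfl <;> simp) h))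
      omega
    -- The inequalities for `maxNum` turn `hdeg` and `htri` into the degree conditions of the dense
    -- or the sparse theorem.
    rcases Nat.lt_or_ge n (4 * (k + 1) + 3) with hd | hd
    · obtain ⟨μ, hμ⟩ := Nat.exists_eq_add_of_le (show 3 * (k + 1) + 2 ≤ n by omega)
      have h3 := maxNum_add_le_dense (n := n - 1) (k := k + 1) (by omega) (by omega)
      have h4 := maxNum_triangle_dense (n := n - 3) (k := k) (by omega) (by omega)
      rw [Nat.sub_add_cancel (by omega)] at h3 h4
      rcases hasDisjointTriangles_or_degSum_le (G := G) (k := k + 1) (μ := μ) (by omega) (by omega)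
        (fun v => by have := hdeg v; omega)
        (fun u v w huv huw hvw => by have := htri u v w huv huw hvw; omega) with h | h | h
      · exact hno h
      · rw [degSum_univ] at h
        have h5 := num₄_le_maxNum (n := n) (k := k + 1) (by omega) (by omega)
        have h6 := four_mul_num₄ (n := n) (k := k + 1) (by omega)
        rw [hμ] at h5 h6 hlt
        push_cast at h6
        zify at h h5 hlt
        nlinarith
      · rw [degSum_univ] at h
        have h5 := num₃_le_maxNum (n := n) (k := k + 1) (by omega)
        have h6 := four_mul_num₃ (n := n) (k := k + 1) (by omega)
        rw [hμ] at h5 h6 hlt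
        push_cast at h6
        zify at h h5 hlt
        nlinarith
    · have h3 := maxNum_add_half_le (n := n - 1) (k := k + 1) (by omega)
      have h4 := maxNum_triangle_sparse (n := n - 3) (k := k) (by omega)
      rw [Nat.sub_add_cancel (by omega)] at h3 h4
      exact hno (hasDisjointTriangles_succ_of_sparse (by omega)
        (fun v => by have := hdeg v; omega)
        (fun u v w huv huw hvw => by have := htri u v w huv huw hvw; omega) hk)

end UpperBound

end DensityCH

/-! ### Edge numbers and existence of the extremal graphs. -/

namespace DensityCH

section ExtremalGraphs

variable {n k : ℕ} {H : SimpleGraph (Fin n)}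

/-- Handshake with explicit neighbourhoods `D u`, whose size is constant on each part of the
constructions. -/
lemma two_mul_numEdges_eq_sum (D : Fin n → Finset (Fin n)) (hD : ∀ u v, H.Adj u v ↔ v ∈ D u) :
    2 * numEdges H = ∑ v, (D v).card := by
  rw [← degSum_univ, degSum]
  refine Finset.sum_congr rfl fun v _ => ?_
  unfold degIn
  congr 1
  ext w
  simp [hD]

lemma exists_three_parts {a b c : ℕ} (h : a + b + c = n) : ∃ X Y Z : Finset (Fin n),
    Partitions [X, Y, Z] ∧ X.card = a ∧ Y.card = b ∧ Z.card = c := by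
  obtain ⟨X, -, hX⟩ := Finset.exists_subset_card_eq
    (show a ≤ (Finset.univ : Finset (Fin n)).card by simp; omega)
  have hXc : (Finset.univ \ X).card = b + c := by
    have := Finset.card_sdiff_add_card_eq_card (Finset.subset_univ X)
    simp only [Finset.card_univ, Fintype.card_fin] at this
    omega
  obtain ⟨Y, hY, hYc⟩ := Finset.exists_subset_card_eq (show b ≤ (Finset.univ \ X).card by omega)
  refine ⟨X, Y, (Finset.univ \ X) \ Y, ⟨?_, ?_⟩, hX, hYc, ?_⟩
  · simp only [List.pairwise_cons, List.mem_cons, List.not_mem_nil, or_false, forall_eq_or_imp,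
      forall_eq, false_imp_iff, implies_true, List.Pairwise.nil, and_true]
    refine ⟨⟨?_, ?_⟩, Finset.disjoint_sdiff⟩
    · exact Finset.disjoint_right.2 fun v hv => (Finset.mem_sdiff.1 (hY hv)).2
    · exact Finset.disjoint_right.2 fun v hv => (Finset.mem_sdiff.1 (Finset.mem_sdiff.1 hv).1).2
  · intro v
    by_cases h1 : v ∈ X
    · exact ⟨X, by simp, h1⟩
    by_cases h2 : v ∈ Y
    · exact ⟨Y, by simp, h2⟩
    · exact ⟨(Finset.univ \ X) \ Y, by simp, by simp [h1, h2]⟩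
  · have := Finset.card_sdiff_add_card_eq_card hY
    omega

lemma Partitions.sum_card {L : List (Finset (Fin n))} (hL : Partitions L) (f : Fin n → ℕ) :
    ∑ v, f v = (L.map fun A => ∑ v ∈ A, f v).sum := by
  obtain ⟨hd, hc⟩ := hL
  have key : ∀ L : List (Finset (Fin n)), L.Pairwise Disjoint → ∀ A : Finset (Fin n),
      (∀ v, v ∈ A ↔ ∃ B ∈ L, v ∈ B) → ∑ v ∈ A, f v = (L.map fun B => ∑ v ∈ B, f v).sum := by
    intro L
    induction L with
    | nil =>
      intro _ A hA
      have hA' : A = ∅ := Finset.eq_empty_of_forall_notMem fun v hv => by simpa using (hA v).1 hv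
      simp [hA']
    | cons B L ih =>
      intro hp A hA
      rw [List.pairwise_cons] at hp
      have hBA : B ⊆ A := fun v hv => (hA v).2 ⟨B, by simp, hv⟩
      rw [List.map_cons, List.sum_cons, ← ih hp.2 (A \ B), add_comm, Finset.sum_sdiff hBA]
      intro v
      rw [Finset.mem_sdiff, hA]
      constructor
      · rintro ⟨⟨C, hC, hv⟩, hvB⟩
        rcases List.mem_cons.1 hC with rfl | hC
        exacts [absurd hv hvB, ⟨C, hC, hv⟩]
      · rintro ⟨C, hC, hv⟩
        exact ⟨⟨C, List.mem_cons_of_mem _ hC, hv⟩, Finset.disjoint_right.1 (hp.1 C hC) hv⟩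
  exact key L hd Finset.univ fun v => by simpa using hc v

lemma sum_card_eq {A : Finset (Fin n)} {f : Fin n → ℕ} {c : ℕ} (h : ∀ v ∈ A, f v = c) :
    ∑ v ∈ A, f v = A.card * c := by
  rw [Finset.sum_congr rfl h, Finset.sum_const, smul_eq_mul]

lemma partitions_two {X Y : Finset (Fin n)} (h : Partitions [X, Y]) :
    Disjoint X Y ∧ ∀ v, v ∈ X ∨ v ∈ Y := by
  simpa [Partitions] using h

lemma partitions_three {X Y Z : Finset (Fin n)} (h : Partitions [X, Y, Z]) :
    Disjoint X Y ∧ Disjoint X Z ∧ Disjoint Y Z ∧ ∀ v, v ∈ X ∨ v ∈ Y ∨ v ∈ Z := by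
  simpa [Partitions, and_assoc] using h

lemma IsE₁.numEdges_eq (hk : k ≤ n) (h : IsE₁ n k H) : numEdges H = num₁ n k := by
  obtain ⟨X, Y₁, Y₂, hP, hX, hY₁, hY₂, hadj⟩ := h
  obtain ⟨d1, d2, d3, hc⟩ := partitions_three hP
  rw [Finset.disjoint_left] at d1 d2 d3
  have h1 := two_mul_numEdges_eq_sum (H := H)
    (fun v => if v ∈ X then Finset.univ.erase v else if v ∈ Y₁ then X ∪ Y₂ else X ∪ Y₁) (by
      intro u v
      have hu := hc u
      have hv := hc v
      rw [hadj]
      unfold Between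
      split_ifs <;> simp <;> grind)
  rw [hP.sum_card] at h1
  have e1 : (X ∪ Y₁).card = k + (n - k + 1) / 2 := by
    rw [Finset.card_union_of_disjoint (Finset.disjoint_left.2 d1), hX, hY₁]
  have e2 : (X ∪ Y₂).card = k + (n - k) / 2 := by
    rw [Finset.card_union_of_disjoint (Finset.disjoint_left.2 d2), hX, hY₂]
  simp only [List.map_cons, List.map_nil, List.sum_cons, List.sum_nil, add_zero] at h1
  rw [sum_card_eq (A := X) (c := n - 1) (by intro v hv; simp [hv]),
    sum_card_eq (A := Y₁) (c := k + (n - k) / 2) (by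
      intro v hv
      rw [if_neg (fun h => d1 h hv), if_pos hv, e2]),
    sum_card_eq (A := Y₂) (c := k + (n - k + 1) / 2) (by
      intro v hv
      rw [if_neg (fun h => d2 h hv), if_neg (fun h => d3 h hv), e1]), hX, hY₁, hY₂] at h1
  obtain ⟨m, rfl⟩ := Nat.exists_eq_add_of_le hk
  have h2 := two_mul_choose_two k
  have h3 : (m + 1) / 2 + m / 2 = m := by omega
  unfold num₁
  rw [show k + m - k = m by omega] at h1 ⊢
  generalize (m + 1) / 2 = p at *
  generalize m / 2 = q at *
  subst h3
  -- For `k = 0` the truncated `n - 1` has coefficient 0; otherwise it is a genuine subtraction.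
  rcases Nat.eq_zero_or_pos k with rfl | hk0
  · simp at h1 ⊢
    nlinarith
  · obtain ⟨j, rfl⟩ := Nat.exists_eq_add_of_lt hk0
    rw [show 0 + j + 1 + (p + q) - 1 = j + (p + q) by omega] at h1
    push_cast at h2
    zify at h1 ⊢
    nlinarith

lemma IsE₂.numEdges_eq (h : IsE₂ n k H) : numEdges H = num₂ n k := by
  obtain ⟨hk, X, Y₁, Y₂, hP, hX, hY, hadj⟩ := h
  obtain ⟨d1, d2, d3, hc⟩ := partitions_three hP
  have e1 : (X ∪ Y₂).card = 2 * k + 1 + Y₂.card := by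
    rw [Finset.card_union_of_disjoint d2, hX]
  have e2 : ∀ v ∈ X, (X.erase v ∪ Y₁).card = 2 * k + Y₁.card := by
    intro v hv
    rw [Finset.card_union_of_disjoint (d1.mono_left (Finset.erase_subset _ _)),
      Finset.card_erase_of_mem hv, hX]
    rfl
  rw [Finset.disjoint_left] at d1 d2 d3
  have h1 := two_mul_numEdges_eq_sum (H := H)
    (fun v => if v ∈ X then X.erase v ∪ Y₁ else if v ∈ Y₁ then X ∪ Y₂ else Y₁) (by
      intro u v
      have hu := hc u
      have hv := hc v
      rw [hadj]
      unfold Between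
      split_ifs <;> simp <;> grind)
  rw [hP.sum_card] at h1
  simp only [List.map_cons, List.map_nil, List.sum_cons, List.sum_nil, add_zero] at h1
  rw [sum_card_eq (A := X) (c := 2 * k + Y₁.card) (by intro v hv; rw [if_pos hv, e2 v hv]),
    sum_card_eq (A := Y₁) (c := 2 * k + 1 + Y₂.card) (by
      intro v hv
      rw [if_neg (fun h => d1 h hv), if_pos hv, e1]),
    sum_card_eq (A := Y₂) (c := Y₁.card) (by
      intro v hv
      rw [if_neg (fun h => d2 h hv), if_neg (fun h => d3 h hv)]), hX] at h1
  have h2 := two_mul_choose_two (2 * k + 1)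
  have h3 : Y₁.card * (2 * k + 1 + Y₂.card) = n / 2 * ((n + 1) / 2) := by
    rcases hY with ⟨a, b⟩ | ⟨a, b⟩
    · rw [a, add_comm (2 * k + 1), b]
    · rw [a, add_comm (2 * k + 1), b, mul_comm]
  unfold num₂
  rw [← h3]
  push_cast at h2
  zify at h1 ⊢
  nlinarith

lemma IsE₃.numEdges_eq (h : IsE₃ n k H) : numEdges H = num₃ n k := by
  obtain ⟨X, Y₁, hP, hX, hY₁, hadj⟩ := h
  obtain ⟨d1, hc⟩ := partitions_two hP
  rw [Finset.disjoint_left] at d1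
  have h1 := two_mul_numEdges_eq_sum (H := H)
    (fun v => if v ∈ X then Finset.univ.erase v else X) (by
      intro u v
      have hu := hc u
      have hv := hc v
      rw [hadj]
      split_ifs <;> simp <;> grind)
  rw [hP.sum_card] at h1
  simp only [List.map_cons, List.map_nil, List.sum_cons, List.sum_nil, add_zero] at h1
  rw [sum_card_eq (A := X) (c := n - 1) (by intro v hv; simp [hv]),
    sum_card_eq (A := Y₁) (c := 2 * k + 1) (by
      intro v hv
      rw [if_neg (fun h => d1 h hv), hX]), hX] at h1
  have h2 := two_mul_choose_two (2 * k + 1)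
  unfold num₃
  rw [show n - 1 = Y₁.card + 2 * k by omega] at h1
  rw [show n - (2 * k + 1) = Y₁.card by omega]
  push_cast at h2
  zify at h1 ⊢
  nlinarith

/-- The size of `X` forces `n ≤ 6k + 4`, so the weaker `n ≤ 6k + 12` admits no further graphs. The
count does not depend on how `n - 3k - 2` is split between `Y₁` and `Y₂`. -/
lemma IsE₄.numEdges_eq (hn : 3 * k + 2 < n) (h : IsE₄ n k H) :
    n ≤ 6 * k + 4 ∧ numEdges H = num₄ n k := by
  obtain ⟨-, ⟨h, -⟩ | ⟨-, X, Y₁, Y₂, Y₃, Y₄, hP, h13, h24, h12, hX, hadj⟩⟩ := h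
  · omega
  refine ⟨by omega, ?_⟩
  have hP' := hP
  simp only [Partitions, List.pairwise_cons, List.mem_cons, List.not_mem_nil, or_false,
    forall_eq_or_imp, forall_eq, false_imp_iff, implies_true, List.Pairwise.nil, and_true,
    exists_eq_or_imp, exists_eq_left] at hP'
  obtain ⟨⟨⟨dX1, dX2, dX3, dX4⟩, ⟨d12, d13, d14⟩, ⟨d23, d24⟩, d34⟩, hc⟩ := hP'
  have cX : ∀ v ∈ X, (X.erase v ∪ (Y₁ ∪ Y₂)).card + 1 = X.card + (Y₁.card + Y₂.card) := by
    intro v hv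
    rw [Finset.card_union_of_disjoint, Finset.card_union_of_disjoint d12]
    · have := Finset.card_erase_add_one hv
      omega
    · exact (Finset.disjoint_union_right.2 ⟨dX1, dX2⟩).mono_left (Finset.erase_subset _ _)
  have c1 : (X ∪ (Y₂ ∪ Y₃)).card = X.card + (Y₂.card + Y₃.card) := by
    rw [Finset.card_union_of_disjoint (Finset.disjoint_union_right.2 ⟨dX2, dX3⟩),
      Finset.card_union_of_disjoint d23]
  have c2 : (X ∪ (Y₁ ∪ Y₄)).card = X.card + (Y₁.card + Y₄.card) := by
    rw [Finset.card_union_of_disjoint (Finset.disjoint_union_right.2 ⟨dX1, dX4⟩),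
      Finset.card_union_of_disjoint d14]
  have c3 := Finset.card_union_of_disjoint d14
  have c4 := Finset.card_union_of_disjoint d23
  rw [Finset.disjoint_left] at dX1 dX2 dX3 dX4 d12 d13 d14 d23 d24 d34
  have h1 := two_mul_numEdges_eq_sum (H := H)
    (fun v => if v ∈ X then X.erase v ∪ (Y₁ ∪ Y₂) else if v ∈ Y₁ then X ∪ (Y₂ ∪ Y₃)
      else if v ∈ Y₂ then X ∪ (Y₁ ∪ Y₄) else if v ∈ Y₃ then Y₁ ∪ Y₄ else Y₂ ∪ Y₃) (by
      intro u v
      have hu := hc u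
      have hv := hc v
      rw [hadj]
      unfold Between
      split_ifs <;> simp <;> grind)
  rw [hP.sum_card] at h1
  simp only [List.map_cons, List.map_nil, List.sum_cons, List.sum_nil, add_zero] at h1
  rw [sum_card_eq (A := X) (c := X.card + (Y₁.card + Y₂.card) - 1) (by
      intro v hv
      rw [if_pos hv, ← cX v hv, Nat.add_sub_cancel]),
    sum_card_eq (A := Y₁) (c := X.card + (Y₂.card + Y₃.card)) (by
      intro v hv
      rw [if_neg (fun h => dX1 h hv), if_pos hv, c1]),
    sum_card_eq (A := Y₂) (c := X.card + (Y₁.card + Y₄.card)) (by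
      intro v hv
      rw [if_neg (fun h => dX2 h hv), if_neg (fun h => d12 h hv), if_pos hv, c2]),
    sum_card_eq (A := Y₃) (c := Y₁.card + Y₄.card) (by
      intro v hv
      rw [if_neg (fun h => dX3 h hv), if_neg (fun h => d13 h hv), if_neg (fun h => d23 h hv),
        if_pos hv, c3]),
    sum_card_eq (A := Y₄) (c := Y₂.card + Y₃.card) (by
      intro v hv
      rw [if_neg (fun h => dX4 h hv), if_neg (fun h => d14 h hv), if_neg (fun h => d24 h hv),
        if_neg (fun h => d34 h hv), c4]), ← h13, ← h24] at h1
  generalize Y₁.card = a at *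
  generalize Y₂.card = b at *
  have h4 := four_mul_num₄ (n := n) (k := k) (by omega)
  -- `|X| + |Y₁| + |Y₂| = 3k + 2`, so the subtraction is not truncated.
  have hc : ((X.card + (a + b) - 1 : ℕ) : ℤ) = X.card + (a + b) - 1 := by
    have : 1 ≤ X.card + (a + b) := by omega
    push_cast [this]
    ring
  zify at h1 h12 hX ⊢
  rw [hc] at h1
  have hx : (X.card : ℤ) = 6 * k + 4 - n := by linarith
  have hb : (b : ℤ) = n - 3 * k - 2 - a := by linarith
  rw [hx, hb] at h1
  nlinarith

lemma isExtremalEdgeNumber₁ (hk : k ≤ n) : IsExtremalEdgeNumber n k 0 (num₁ n k) := by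
  refine ⟨?_, fun H hH => IsE₁.numEdges_eq hk hH⟩
  obtain ⟨X, Y₁, Y₂, hP, hX, hY₁, hY₂⟩ := exists_three_parts
    (n := n) (a := k) (b := (n - k + 1) / 2) (c := (n - k) / 2) (by omega)
  refine ⟨SimpleGraph.fromRel fun u v => u ∈ X ∨ v ∈ X ∨ Between Y₁ Y₂ u v,
    X, Y₁, Y₂, hP, hX, hY₁, hY₂, fun u v => ?_⟩
  rw [SimpleGraph.fromRel_adj]
  unfold Between
  tauto

lemma isExtremalEdgeNumber₂ (hk : 4 * k + 2 ≤ n) : IsExtremalEdgeNumber n k 1 (num₂ n k) := by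
  refine ⟨?_, fun H hH => IsE₂.numEdges_eq hH⟩
  obtain ⟨X, Y₁, Y₂, hP, hX, hY₁, hY₂⟩ := exists_three_parts
    (n := n) (a := 2 * k + 1) (b := n / 2) (c := (n + 1) / 2 - (2 * k + 1)) (by omega)
  refine ⟨SimpleGraph.fromRel fun u v => (u ∈ X ∧ v ∈ X) ∨ Between Y₁ (X ∪ Y₂) u v,
    by omega, X, Y₁, Y₂, hP, hX, Or.inl ⟨hY₁, by omega⟩, fun u v => ?_⟩
  rw [SimpleGraph.fromRel_adj]
  unfold Between
  tauto

lemma isExtremalEdgeNumber₃ (hk : 2 * k + 1 ≤ n) : IsExtremalEdgeNumber n k 2 (num₃ n k) := by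
  refine ⟨?_, fun H hH => IsE₃.numEdges_eq hH⟩
  obtain ⟨X, -, hX⟩ := Finset.exists_subset_card_eq
    (show 2 * k + 1 ≤ (Finset.univ : Finset (Fin n)).card by simpa using hk)
  refine ⟨SimpleGraph.fromRel fun u v => u ∈ X ∨ v ∈ X, X, Xᶜ, ⟨?_, fun v => ?_⟩, hX, ?_,
    fun u v => ?_⟩
  · simpa using disjoint_compl_right
  · by_cases hv : v ∈ X
    · exact ⟨X, by simp, hv⟩
    · exact ⟨Xᶜ, by simp, by simpa using hv⟩
  · rw [Finset.card_compl, Fintype.card_fin, hX]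
    omega
  · rw [SimpleGraph.fromRel_adj]
    tauto

lemma isExtremalEdgeNumber₄ (hk : 3 * k + 2 < n) (hn : n ≤ 6 * k + 4) :
    IsExtremalEdgeNumber n k 3 (num₄ n k) := by
  refine ⟨?_, fun H hH => (IsE₄.numEdges_eq hk hH).2⟩
  obtain ⟨X, Y₁, Y₃, hP, hX, hY₁, hY₃⟩ := exists_three_parts
    (n := n) (a := 6 * k + 4 - n) (b := n - (3 * k + 2)) (c := n - (3 * k + 2)) (by omega)
  -- One member of the class suffices; the simplest has `Y₂ = Y₄ = ∅`.
  refine ⟨SimpleGraph.fromRel fun u v => (u ∈ X ∧ v ∈ X) ∨ Between X (Y₁ ∪ ∅) u v ∨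
      Between (Y₁ ∪ ∅) (∅ ∪ Y₃) u v, by omega, Or.inr ⟨hk, X, Y₁, ∅, Y₃, ∅, ?_, ?_, rfl, ?_, ?_,
    fun u v => ?_⟩⟩
  · obtain ⟨d1, d2, d3, hc⟩ := partitions_three hP
    simp [Partitions, d1, d2, d3]
    exact hc
  · rw [hY₁, hY₃]
  · rw [hY₁, Finset.card_empty]; omega
  · omega
  · have hs : ∀ A B : Finset (Fin n), Between A B v u ↔ Between A B u v := by
      intro A B
      unfold Between
      tauto
    rw [SimpleGraph.fromRel_adj, hs, hs, and_comm (a := v ∈ X), or_self]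

lemma isExtremalEdgeNumber_complete (hk : 3 * k ≤ n) (hn : n ≤ 3 * k + 2) :
    IsExtremalEdgeNumber n k 3 (n.choose 2) := by
  refine ⟨⟨⊤, by omega, Or.inl ⟨hn, rfl⟩⟩, ?_⟩
  rintro H ⟨-, ⟨-, rfl⟩ | ⟨h, -⟩⟩
  · have h1 := two_mul_numEdges_eq_sum (H := (⊤ : SimpleGraph (Fin n)))
      (fun v => Finset.univ.erase v) (by intro u v; simp [eq_comm])
    simp only [Finset.card_erase_of_mem (Finset.mem_univ _), Finset.card_univ, Fintype.card_fin,
      Finset.sum_const, smul_eq_mul] at h1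
    rw [Nat.choose_two_right]
    omega
  · omega

lemma le_maxNum_of_isExtremalEdgeNumber (hk : 3 * k ≤ n) {j : Fin 4} {m : ℕ}
    (h : IsExtremalEdgeNumber n k j m) : m ≤ maxNum n k := by
  obtain ⟨⟨H, hH⟩, hm⟩ := h
  rw [← hm H hH]
  rcases Nat.lt_or_ge n (3 * k + 3) with hn | hn
  · rw [maxNum, if_pos (by omega)]
    simpa using numEdges_le_choose H
  fin_cases j
  · rw [IsE₁.numEdges_eq (by omega) hH]
    exact num₁_le_maxNum hn
  · have hH' : IsE₂ n k H := hH
    rw [hH'.numEdges_eq]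
    exact num₂_le_maxNum hn (by have := hH'.1; omega)
  · rw [IsE₃.numEdges_eq hH]
    exact num₃_le_maxNum hn
  · obtain ⟨h1, h2⟩ := IsE₄.numEdges_eq (by omega) hH
    rw [h2]
    exact num₄_le_maxNum hn h1

lemma exists_isExtremalEdgeNumber_maxNum (hk : 3 * k ≤ n) :
    ∃ j, IsExtremalEdgeNumber n k j (maxNum n k) := by
  unfold maxNum
  split_ifs with h1 h2 h3 h3
  · exact ⟨3, isExtremalEdgeNumber_complete hk h1⟩
  all_goals
    have e1 : ∃ j, IsExtremalEdgeNumber n k j (num₁ n k) := ⟨0, isExtremalEdgeNumber₁ (by omega)⟩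
    have e3 : ∃ j, IsExtremalEdgeNumber n k j (num₃ n k) := ⟨2, isExtremalEdgeNumber₃ (by omega)⟩
    have e13 : ∃ j, IsExtremalEdgeNumber n k j (max (num₁ n k) (num₃ n k)) := by
      rcases max_choice (num₁ n k) (num₃ n k) with h | h <;> rw [h] <;> assumption
  · have e2 : ∃ j, IsExtremalEdgeNumber n k j (num₂ n k) := ⟨1, isExtremalEdgeNumber₂ h2⟩
    have e4 : ∃ j, IsExtremalEdgeNumber n k j (num₄ n k) :=
      ⟨3, isExtremalEdgeNumber₄ (by omega) h3⟩
    rcases max_choice (max (num₁ n k) (num₃ n k)) (max (num₂ n k) (num₄ n k)) with h | h <;> rw [h]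
    · exact e13
    · rcases max_choice (num₂ n k) (num₄ n k) with h | h <;> rw [h] <;> assumption
  · have e2 : ∃ j, IsExtremalEdgeNumber n k j (num₂ n k) := ⟨1, isExtremalEdgeNumber₂ h2⟩
    rw [max_eq_left (Nat.zero_le (num₂ n k))]
    rcases max_choice (max (num₁ n k) (num₃ n k)) (num₂ n k) with h | h <;> rw [h] <;> assumption
  · have e4 : ∃ j, IsExtremalEdgeNumber n k j (num₄ n k) :=
      ⟨3, isExtremalEdgeNumber₄ (by omega) h3⟩
    rw [max_eq_right (Nat.zero_le (num₄ n k))]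
    rcases max_choice (max (num₁ n k) (num₃ n k)) (num₄ n k) with h | h <;> rw [h] <;> assumption
  · rw [max_self, max_eq_left (Nat.zero_le _)]
    exact e13

end ExtremalGraphs

end DensityCH

/-- The number `M` is the maximum of `e(E_j(n,k))` over those `j ∈ [4]` for which `E_j(n,k)` is
defined. -/
theorem mainTheorem1 :
    ∃ n₀ : ℕ, ∀ n : ℕ, n₀ < n → ∀ k : ℕ, (k : ℝ) ≤ (n : ℝ) / 3 →
      ∃ M : ℕ,
        IsGreatest {m : ℕ | ∃ j : Fin 4, DensityCH.IsExtremalEdgeNumber n k j m} M ∧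
        ∀ (V : Type*) [Fintype V] (G : SimpleGraph V), Fintype.card V = n →
          ¬ DensityCH.HasDisjointTriangles G (k + 1) →
          DensityCH.numEdges G ≤ M := by
  -- The bound holds for every `n`, so any `n₀` would do.
  refine ⟨0, fun n _ k hk => ?_⟩
  have hk' : 3 * k ≤ n := by
    have : (3 : ℝ) * k ≤ n := by linarith
    exact_mod_cast this
  refine ⟨DensityCH.maxNum n k, ⟨DensityCH.exists_isExtremalEdgeNumber_maxNum hk', ?_⟩, ?_⟩
  · rintro m ⟨j, hj⟩
    exact DensityCH.le_maxNum_of_isExtremalEdgeNumber hk' hj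
  · intro V _ G hV hno
    exact DensityCH.numEdges_le_maxNum n k hk' V G hV hno
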